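/- Let $d$ be a natural number, $\mathbb D$ the open unit disc in $\mathbb C$, and let $H^2(\mathbb D^d)$ be the Hardy space over the polydisc, i.e. the Hilbert space of analytic functions $f$ on $\mathbb D^d$ with $\|f\|^2=\sup_{0<r<1}\int_{\mathbb T^d}|f(rz)|^2\,dm(z)<\infty$, where $m$ is the normalized Haar measure on $\mathbb T^d$. For an ideal $I\subset\mathbb C[z_1,\dots,z_d]$ let $[I]$ be the closure of $I$ in $H^2(\mathbb D^d)$ and let $\mathcal N=[I]^\perp$ be its orthogonal complement. Put $S_{z_i}=P_{\mathcal N}M_{z_i}|_{\mathcal N}$ for $1\le i\le d$, where $M_{z_i}$ is multiplication by $z_i$ and $P_{\mathcal N}$ is the orthogonal projection onto $\mathcal N$. The space $\mathcal N$ is called essentially normal if all the commutators $[S_{z_i}^*,S_{z_j}]$, $1\le i,j\le d$, are compact. An operator $S\in B(\mathcal N)$ is called essentially unitary if both $1-SS^*$ and $1-S^*S$ are compact. Let $u$ be a point of the topological boundary $\partial\mathbb D^d$ of $\mathbb D^d$ in $\mathbb C^d$, put $V_u=\{\lambda u:\lambda\in\mathbb D\}$ and $\Lambda=\{i:|u_i|=1\}$,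 and let $J_u$ be the ideal generated by all $\bar u_iz_i-\bar u_jz_j$ with $i,j\in\Lambda$. Let $I\subset\mathbb C[z_1,\dots,z_d]$ be a homogeneous ideal whose zero set in $\mathbb D^d$ is $V_u$, and suppose that $I$ is essentially quasi-prime, i.e. that the complex vector space $\sqrt I/(I+J_u)$ is finite-dimensional. Then $\mathcal N=[I]^\perp$ is essentially normal. Moreover, there are an essentially unitary operator $S\in B(\mathcal N)$ and compact operators $K_1,\dots,K_d\in B(\mathcal N)$ such that $S_{z_i}=u_iS+K_i$ for all $1\le i\le d$. -/

import Mathlib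

open MeasureTheory Set Topology
open scoped ENNReal NNReal ComplexConjugate

noncomputable section

namespace PolydiscHardy

variable {d : ℕ}

/-- The open unit polydisc. -/
def polydisc (d : ℕ) : Set (Fin d → ℂ) := {z | ∀ i, ‖z i‖ < 1}

/-- The normalized Haar measure on the torus, written as a power of `ℝ / ℤ`. -/
def torusMeasure (d : ℕ) : Measure (Fin d → UnitAddCircle) :=
  Measure.pi fun _ => AddCircle.haarAddCircle

/-- The point of the torus in `ℂ ^ d` with arguments `2 * π * t i`. -/
def torusPoint (t : Fin d → UnitAddCircle) : Fin d → ℂ := fun i => (AddCircle.toCircle (t i) : ℂ)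

/-- The square of the Hardy norm, with values in `[0, ∞]`. -/
def hardySq (f : (Fin d → ℂ) → ℂ) : ℝ≥0∞ :=
  ⨆ r ∈ Ioo (0 : ℝ) 1, ∫⁻ t, ‖f ((r : ℂ) • torusPoint t)‖ₑ ^ 2 ∂torusMeasure d

instance : IsProbabilityMeasure (torusMeasure d) := by
  unfold torusMeasure; infer_instance

theorem polydisc_eq_ball : polydisc d = Metric.ball 0 1 := by
  ext z
  simp [polydisc, pi_norm_lt_iff]

theorem isOpen_polydisc : IsOpen (polydisc d) := by
  rw [polydisc_eq_ball]; exact Metric.isOpen_ball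

theorem norm_torusPoint (t : Fin d → UnitAddCircle) (i : Fin d) : ‖torusPoint t i‖ = 1 :=
  Circle.norm_coe _

theorem continuous_torusPoint : Continuous (torusPoint (d := d)) := by
  unfold torusPoint
  have := AddCircle.continuous_toCircle (T := 1)
  fun_prop

theorem smul_mem_polydisc {r : ℝ} (hr : r ∈ Ioo (0 : ℝ) 1) {w : Fin d → ℂ}
    (hw : ∀ i, ‖w i‖ ≤ 1) : (r : ℂ) • w ∈ polydisc d := by
  intro i
  have h := hw i
  simp only [Pi.smul_apply, smul_eq_mul, norm_mul, Complex.norm_real, Real.norm_eq_abs,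
    abs_of_pos hr.1]
  nlinarith [hr.1, hr.2]

theorem radial_mem (r : ℝ) (hr : r ∈ Ioo (0 : ℝ) 1) (t : Fin d → UnitAddCircle) :
    (r : ℂ) • torusPoint t ∈ polydisc d :=
  smul_mem_polydisc hr fun i => (norm_torusPoint t i).le

theorem continuous_radial {f : (Fin d → ℂ) → ℂ} (hf : AnalyticOnNhd ℂ f (polydisc d))
    {r : ℝ} (hr : r ∈ Ioo (0 : ℝ) 1) : Continuous fun t => f ((r : ℂ) • torusPoint t) :=
  hf.continuousOn.comp_continuous ((continuous_const_smul _).comp continuous_torusPoint) (radial_mem r hr)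

/-- Expansion of an analytic function on the polydisc in homogeneous terms, with a Cauchy bound. -/
theorem slice {f : (Fin d → ℂ) → ℂ} (hf : AnalyticOnNhd ℂ f (polydisc d))
    {p : FormalMultilinearSeries ℂ (Fin d → ℂ) ℂ} (hp : HasFPowerSeriesAt f p 0)
    {s : ℝ} (hs : s ∈ Ioo (0 : ℝ) 1) :
    ∃ M : ℝ, ∀ w : Fin d → ℂ, (∀ i, ‖w i‖ ≤ 1) →
      (∀ k, ‖p k fun _ => w‖ ≤ M * (s⁻¹) ^ k) ∧
      ∀ r ∈ Ioo (0 : ℝ) s, HasSum (fun k => (r : ℂ) ^ k * p k fun _ => w) (f ((r : ℂ) • w)) := by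
  have hK : IsCompact (Metric.closedBall (0 : Fin d → ℂ) s) := isCompact_closedBall _ _
  have hKs : Metric.closedBall (0 : Fin d → ℂ) s ⊆ polydisc d := by
    rw [polydisc_eq_ball]; exact Metric.closedBall_subset_ball hs.2
  obtain ⟨M, hM⟩ := hK.exists_bound_of_continuousOn (hf.continuousOn.mono hKs)
  refine ⟨M, fun w hw => ?_⟩
  have hw1 : ‖w‖ ≤ 1 := (pi_norm_le_iff_of_nonneg zero_le_one).2 hw
  have hmem : ∀ l : ℂ, ‖l‖ ≤ s → l • w ∈ Metric.closedBall (0 : Fin d → ℂ) s := by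
    intro l hl
    rw [mem_closedBall_zero_iff, norm_smul]
    nlinarith [norm_nonneg l, norm_nonneg w]
  set L : ℂ →L[ℂ] (Fin d → ℂ) := (ContinuousLinearMap.id ℂ ℂ).smulRight w with hL
  have hLa : ∀ l : ℂ, L l = l • w := fun l => by simp [hL]
  set φ : ℂ → ℂ := fun l => f (l • w) with hφ
  lift s to ℝ≥0 using hs.1.le
  have hs0 : 0 < s := by exact_mod_cast hs.1
  have hd : DifferentiableOn ℂ φ (Metric.closedBall 0 s) := by
    intro l hl
    have h1 : DifferentiableAt ℂ f (l • w) :=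
      (hf _ (hKs (hmem l (by simpa using hl)))).differentiableAt
    exact (h1.comp l ((differentiableAt_id).smul_const w)).differentiableWithinAt
  have h1 := hd.hasFPowerSeriesOnBall hs0
  have h2 : HasFPowerSeriesAt φ (p.compContinuousLinearMap L) 0 := by
    have := HasFPowerSeriesAt.compContinuousLinearMap (f := f) (u := L) (x := 0) (pf := p)
      (by simpa using hp)
    refine this.congr (Filter.Eventually.of_forall fun l => ?_)
    simp [hφ, hLa]
  have h3 := h1.hasFPowerSeriesAt.eq_formalMultilinearSeries h2
  rw [h3] at h1
  have hval : ∀ k (l : ℂ), (p.compContinuousLinearMap L k fun _ => l) = l ^ k * p k fun _ => w := by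
    intro k l
    rw [FormalMultilinearSeries.compContinuousLinearMap_apply]
    have : (⇑L ∘ fun _ : Fin k => l) = fun _ => l • w := by ext; simp [hLa]
    rw [this]
    have := (p k).map_smul_univ (fun _ => l) (fun _ => w)
    simpa using this
  constructor
  · intro k
    have h4 : (p k fun _ => w) = (p.compContinuousLinearMap L k fun _ => (1 : ℂ)) := by
      rw [hval]; simp
    rw [h4, ← h3]
    refine (ContinuousMultilinearMap.le_opNorm _ _).trans ?_
    simp only [norm_one, Finset.prod_const_one, mul_one]
    refine (norm_cauchyPowerSeries_le _ _ _ _).trans ?_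
    have hs' : |(s : ℝ)| = s := abs_of_pos hs.1
    rw [hs']
    gcongr
    have h5 : ∀ θ : ℝ, ‖φ (circleMap 0 s θ)‖ ≤ M := fun θ => hM _ (hmem _ (by simp))
    have h6 := intervalIntegral.norm_integral_le_of_norm_le_const (a := 0) (b := 2 * Real.pi)
      (f := fun θ => ‖φ (circleMap 0 s θ)‖) (C := M) (fun θ _ => by simpa using h5 θ)
    have h7 := (le_abs_self _).trans h6
    rw [sub_zero, abs_of_pos Real.two_pi_pos] at h7
    rw [inv_mul_le_iff₀ Real.two_pi_pos]
    linarith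
  · intro r hr
    have h4 := h1.hasSum (y := (r : ℂ)) (by
      simp only [Metric.mem_eball, edist_zero_right]
      rw [← ofReal_norm, Complex.norm_real, Real.norm_eq_abs, abs_of_pos hr.1]
      have := hr.2
      rw [← ENNReal.ofReal_coe_nnreal]
      exact (ENNReal.ofReal_lt_ofReal_iff hs.1).2 hr.2)
    simpa [hval, hφ] using h4

/-- Fourier coefficients of `f` restricted to the torus of radius `r`. -/
def fc (f : (Fin d → ℂ) → ℂ) (r : ℝ) (n : Fin d → ℤ) : ℂ :=
  ∫ t, UnitAddTorus.mFourier (-n) t * f ((r : ℂ) • torusPoint t) ∂torusMeasure d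

theorem orth (n m : Fin d → ℤ) :
    ∫ t, UnitAddTorus.mFourier (-n) t * UnitAddTorus.mFourier m t ∂torusMeasure d =
      if n = m then 1 else 0 := by
  have h := orthonormal_iff_ite.1 (UnitAddTorus.orthonormal_mFourier (d := Fin d)) n m
  simp only [UnitAddTorus.mFourierLp, ContinuousMap.inner_toLp, ← UnitAddTorus.mFourier_neg] at h
  rw [← h]
  refine integral_congr_ae (Filter.Eventually.of_forall fun t => mul_comm _ _)

theorem parseval {g : (Fin d → UnitAddCircle) → ℂ} (hg : Continuous g) :
    HasSum (fun n => ‖∫ t, UnitAddTorus.mFourier (-n) t * g t ∂torusMeasure d‖ ^ 2)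
      (∫ t, ‖g t‖ ^ 2 ∂torusMeasure d) := by
  let G : C(UnitAddTorus (Fin d), ℂ) := ⟨g, hg⟩
  have h := UnitAddTorus.hasSum_sq_mFourierCoeff (ContinuousMap.toLp 2 (torusMeasure d) ℂ G)
  have h2 : (∫ t, ‖ContinuousMap.toLp 2 (torusMeasure d) ℂ G t‖ ^ 2 ∂torusMeasure d) =
      ∫ t, ‖g t‖ ^ 2 ∂torusMeasure d := by
    refine integral_congr_ae ?_
    filter_upwards [ContinuousMap.coeFn_toLp (p := 2) (𝕜 := ℂ) (torusMeasure d) G] with t ht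
    rw [ht]; rfl
  rw [← h2]
  refine h.congr_fun fun n => ?_
  have := UnitAddTorus.mFourierCoeff_toLp G n
  congr 2
  exact this.symm

/-- The multi-index of a word. -/
def cnt {k : ℕ} (v : Fin k → Fin d) (i : Fin d) : ℕ := (Finset.univ.filter fun j => v j = i).card

theorem prod_word {k : ℕ} (v : Fin k → Fin d) (w : Fin d → ℂ) :
    ∏ j, w (v j) = ∏ i, w i ^ cnt v i := by
  classical
  rw [← Finset.prod_fiberwise (s := Finset.univ) (g := v)]
  refine Finset.prod_congr rfl fun i _ => ?_
  rw [cnt, ← Finset.prod_const]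
  refine Finset.prod_congr rfl fun j hj => ?_
  rw [(Finset.mem_filter.1 hj).2]

theorem sum_cnt {k : ℕ} (v : Fin k → Fin d) : ∑ i, cnt v i = k := by
  classical
  have := Finset.card_eq_sum_card_fiberwise (f := v) (s := Finset.univ) (t := Finset.univ)
    (fun _ _ => Finset.mem_coe.2 (Finset.mem_univ _))
  simpa [cnt] using this.symm

theorem monomial_torus (α : Fin d → ℕ) (t : Fin d → UnitAddCircle) :
    ∏ i, torusPoint t i ^ α i = UnitAddTorus.mFourier (fun i => (α i : ℤ)) t := by
  simp only [UnitAddTorus.mFourier, ContinuousMap.coe_mk, torusPoint, fourier_apply]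
  refine Finset.prod_congr rfl fun i _ => ?_
  rw [natCast_zsmul, AddCircle.toCircle_nsmul, Circle.coe_pow]

/-- The word coefficients of a formal series. -/
def wordCoeff (p : FormalMultilinearSeries ℂ (Fin d → ℂ) ℂ) (k : ℕ) (v : Fin k → Fin d) : ℂ :=
  p k fun j => Pi.single (v j) 1

theorem series_word (p : FormalMultilinearSeries ℂ (Fin d → ℂ) ℂ) (k : ℕ) (w : Fin d → ℂ) :
    (p k fun _ => w) = ∑ v : Fin k → Fin d, wordCoeff p k v * ∏ i, w i ^ cnt v i := by
  have hw : w = ∑ i, w i • (Pi.single i 1 : Fin d → ℂ) := by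
    ext i
    simp [Finset.sum_apply, Pi.single_apply]
  conv_lhs => rw [hw]
  rw [ContinuousMultilinearMap.map_sum]
  refine Finset.sum_congr rfl fun v _ => ?_
  rw [ContinuousMultilinearMap.map_smul_univ, smul_eq_mul, mul_comm, prod_word, wordCoeff]

/-- The multi-index coefficients of a formal series. -/
def multiCoeff (p : FormalMultilinearSeries ℂ (Fin d → ℂ) ℂ) (k : ℕ) (n : Fin d → ℤ) : ℂ :=
  ∑ v : Fin k → Fin d, if n = (fun i => (cnt v i : ℤ)) then wordCoeff p k v else 0

theorem multiCoeff_eq_zero (p : FormalMultilinearSeries ℂ (Fin d → ℂ) ℂ) (k : ℕ) (n : Fin d → ℤ)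
    (h : ¬ ∃ α : Fin d → ℕ, n = (fun i => (α i : ℤ)) ∧ ∑ i, α i = k) : multiCoeff p k n = 0 := by
  refine Finset.sum_eq_zero fun v _ => ?_
  rw [if_neg]
  intro hv
  exact h ⟨cnt v, hv, sum_cnt v⟩

theorem integral_series (p : FormalMultilinearSeries ℂ (Fin d → ℂ) ℂ) (k : ℕ) (n : Fin d → ℤ) :
    ∫ t, UnitAddTorus.mFourier (-n) t * (p k fun _ => torusPoint t) ∂torusMeasure d =
      multiCoeff p k n := by
  simp only [series_word, monomial_torus, Finset.mul_sum]
  rw [integral_finsetSum]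
  · refine Finset.sum_congr rfl fun v _ => ?_
    have : ∀ t, UnitAddTorus.mFourier (-n) t * (wordCoeff p k v *
        UnitAddTorus.mFourier (fun i => (cnt v i : ℤ)) t) = wordCoeff p k v *
        (UnitAddTorus.mFourier (-n) t * UnitAddTorus.mFourier (fun i => (cnt v i : ℤ)) t) :=
      fun t => by ring
    simp only [this]
    rw [integral_const_mul, orth]
    simp
  · intro v _
    refine Continuous.integrable_of_hasCompactSupport ?_ (HasCompactSupport.of_compactSpace _)
    fun_prop

theorem fc_eq {f : (Fin d → ℂ) → ℂ} (hf : AnalyticOnNhd ℂ f (polydisc d))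
    {p : FormalMultilinearSeries ℂ (Fin d → ℂ) ℂ} (hp : HasFPowerSeriesAt f p 0)
    {r : ℝ} (hr : r ∈ Ioo (0 : ℝ) 1) (n : Fin d → ℤ) :
    HasSum (fun k => (r : ℂ) ^ k * multiCoeff p k n) (fc f r n) := by
  set s := (r + 1) / 2 with hs
  have hs1 : s ∈ Ioo (0 : ℝ) 1 := ⟨by linarith [hr.1], by linarith [hr.2]⟩
  have hrs : r ∈ Ioo (0 : ℝ) s := ⟨hr.1, by linarith [hr.2]⟩
  obtain ⟨M, hM⟩ := slice hf hp hs1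
  have hM' := fun t => hM (torusPoint t) fun i => (norm_torusPoint t i).le
  have hF : ∀ (n : Fin d → ℤ) t, ‖UnitAddTorus.mFourier n t‖ ≤ 1 := fun n t =>
    (ContinuousMap.norm_coe_le_norm _ t).trans UnitAddTorus.mFourier_norm.le
  set F : ℕ → (Fin d → UnitAddCircle) → ℂ := fun k t =>
    UnitAddTorus.mFourier (-n) t * ((r : ℂ) ^ k * p k fun _ => torusPoint t) with hFdef
  have hFc : ∀ k, Continuous (F k) := by
    intro k
    have : Continuous fun t => p k fun _ => torusPoint (d := d) t :=
      (p k).cont.comp (continuous_pi fun _ => continuous_torusPoint)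
    exact (UnitAddTorus.mFourier (-n)).continuous.mul (continuous_const.mul this)
  have hint : ∀ k, Integrable (F k) (torusMeasure d) := fun k =>
    (hFc k).integrable_of_hasCompactSupport (HasCompactSupport.of_compactSpace _)
  have hb : ∀ k t, ‖F k t‖ ≤ M * (r / s) ^ k := by
    intro k t
    have h1 := (hM' t).1 k
    simp only [hFdef, norm_mul, norm_pow, Complex.norm_real, Real.norm_eq_abs, abs_of_pos hr.1]
    have h2 := hF (-n) t
    have h3 : 0 < r ^ k := pow_pos hr.1 k
    calc _ ≤ 1 * (r ^ k * (M * s⁻¹ ^ k)) := by gcongr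
      _ = _ := by rw [div_eq_mul_inv, mul_pow]; ring
  have hsum : Summable fun k => M * (r / s) ^ k :=
    (summable_geometric_of_lt_one (div_nonneg hr.1.le hs1.1.le)
      ((div_lt_one hs1.1).2 hrs.2)).mul_left M
  have h4 := hasSum_integral_of_summable_integral_norm (F := F) hint (by
    refine Summable.of_nonneg_of_le (fun k => integral_nonneg fun t => norm_nonneg _)
      (fun k => ?_) hsum
    refine (integral_mono (hint k).norm (integrable_const (M * (r / s) ^ k)) (hb k)).trans ?_
    simp)
  have h5 : (∫ t, ∑' k, F k t ∂torusMeasure d) = fc f r n := by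
    refine integral_congr_ae (Filter.Eventually.of_forall fun t => ?_)
    exact (((hM' t).2 r hrs).mul_left (UnitAddTorus.mFourier (-n) t)).tsum_eq
  rw [h5] at h4
  refine h4.congr_fun fun k => ?_
  rw [← integral_series, ← integral_const_mul]
  refine integral_congr_ae (Filter.Eventually.of_forall fun t => ?_)
  simp only [hFdef]; ring

/-- Taylor coefficients at the origin of a function analytic on the polydisc. -/
def coeff (f : (Fin d → ℂ) → ℂ) (α : Fin d → ℕ) : ℂ :=
  2 ^ (∑ i, α i) * fc f (1 / 2) fun i => (α i : ℤ)

theorem half_mem : (1 / 2 : ℝ) ∈ Ioo (0 : ℝ) 1 := by constructor <;> norm_num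

theorem fc_zero {f : (Fin d → ℂ) → ℂ} (hf : AnalyticOnNhd ℂ f (polydisc d))
    {r : ℝ} (hr : r ∈ Ioo (0 : ℝ) 1) (n : Fin d → ℤ)
    (hn : ¬ ∃ α : Fin d → ℕ, n = fun i => (α i : ℤ)) : fc f r n = 0 := by
  obtain ⟨p, hp⟩ := hf 0 (by intro i; simp)
  have h := fc_eq hf hp hr n
  have h0 : ∀ k, multiCoeff p k n = 0 := fun k =>
    multiCoeff_eq_zero p k n fun ⟨α, h1, _⟩ => hn ⟨α, h1⟩
  simp only [h0, mul_zero] at h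
  exact h.unique hasSum_zero

theorem fc_multi {f : (Fin d → ℂ) → ℂ} (hf : AnalyticOnNhd ℂ f (polydisc d))
    {p : FormalMultilinearSeries ℂ (Fin d → ℂ) ℂ} (hp : HasFPowerSeriesAt f p 0)
    {r : ℝ} (hr : r ∈ Ioo (0 : ℝ) 1) (α : Fin d → ℕ) :
    fc f r (fun i => (α i : ℤ)) =
      (r : ℂ) ^ (∑ i, α i) * multiCoeff p (∑ i, α i) fun i => (α i : ℤ) := by
  have h := fc_eq hf hp hr (fun i => (α i : ℤ))
  refine h.unique (hasSum_single _ fun k hk => ?_)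
  rw [multiCoeff_eq_zero, mul_zero]
  rintro ⟨β, h1, h2⟩
  have : α = β := by
    ext i
    have := congrFun h1 i
    exact_mod_cast this
  exact hk (by rw [← h2, this])

theorem coeff_multi {f : (Fin d → ℂ) → ℂ} (hf : AnalyticOnNhd ℂ f (polydisc d))
    {p : FormalMultilinearSeries ℂ (Fin d → ℂ) ℂ} (hp : HasFPowerSeriesAt f p 0)
    (α : Fin d → ℕ) : coeff f α = multiCoeff p (∑ i, α i) fun i => (α i : ℤ) := by
  rw [coeff, fc_multi hf hp half_mem, ← mul_assoc, ← mul_pow]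
  norm_num

theorem fc_coeff {f : (Fin d → ℂ) → ℂ} (hf : AnalyticOnNhd ℂ f (polydisc d))
    {r : ℝ} (hr : r ∈ Ioo (0 : ℝ) 1) (α : Fin d → ℕ) :
    fc f r (fun i => (α i : ℤ)) = (r : ℂ) ^ (∑ i, α i) * coeff f α := by
  obtain ⟨p, hp⟩ := hf 0 (by intro i; simp)
  rw [fc_multi hf hp hr, coeff_multi hf hp]

theorem castInt_injective : Function.Injective fun (α : Fin d → ℕ) (i : Fin d) => (α i : ℤ) := by
  intro α β h
  ext i
  have : (α i : ℤ) = β i := congrFun h i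
  exact_mod_cast this

theorem lintegral_radial {f : (Fin d → ℂ) → ℂ} (hf : AnalyticOnNhd ℂ f (polydisc d))
    {r : ℝ} (hr : r ∈ Ioo (0 : ℝ) 1) :
    ∫⁻ t, ‖f ((r : ℂ) • torusPoint t)‖ₑ ^ 2 ∂torusMeasure d =
      ∑' α : Fin d → ℕ, ENNReal.ofReal ((r ^ (∑ i, α i) * ‖coeff f α‖) ^ 2) := by
  have hc := continuous_radial hf hr
  have h := parseval hc
  change HasSum (fun n => ‖fc f r n‖ ^ 2) _ at h
  rw [← castInt_injective.hasSum_iff] at h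
  · have h1 : ∀ α : Fin d → ℕ, ((fun n => ‖fc f r n‖ ^ 2) ∘ fun (α : Fin d → ℕ) i => (α i : ℤ)) α =
        (r ^ (∑ i, α i) * ‖coeff f α‖) ^ 2 := by
      intro α
      simp only [Function.comp_apply]
      rw [fc_coeff hf hr, norm_mul, norm_pow, Complex.norm_real, Real.norm_eq_abs, abs_of_pos hr.1]
    have h2 := h.congr_fun (fun α => (h1 α).symm)
    rw [← ENNReal.ofReal_tsum_of_nonneg (fun α => by positivity) h2.summable, h2.tsum_eq,
      ofReal_integral_eq_lintegral_ofReal]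
    · refine lintegral_congr fun t => ?_
      rw [ENNReal.ofReal_pow (norm_nonneg _), ofReal_norm]
    · exact Continuous.integrable_of_hasCompactSupport (hc.norm.pow 2)
        (HasCompactSupport.of_compactSpace _)
    · exact Filter.Eventually.of_forall fun t => by positivity
  · intro n hn
    rw [fc_zero hf hr]
    · simp
    · rintro ⟨α, h1⟩
      exact hn ⟨α, h1.symm⟩

theorem hardySq_eq {f : (Fin d → ℂ) → ℂ} (hf : AnalyticOnNhd ℂ f (polydisc d)) :
    hardySq f = ∑' α, ENNReal.ofReal (‖coeff f α‖ ^ 2) := by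
  apply le_antisymm
  · refine iSup₂_le fun r hr => ?_
    rw [lintegral_radial hf hr]
    refine ENNReal.tsum_le_tsum fun α => ENNReal.ofReal_le_ofReal ?_
    have h1 : r ^ (∑ i, α i) ≤ 1 := pow_le_one₀ hr.1.le hr.2.le
    have h0 : 0 < r := hr.1
    gcongr
    nlinarith [norm_nonneg (coeff f α)]
  · rw [ENNReal.tsum_eq_iSup_sum]
    refine iSup_le fun s => ?_
    have ht : Filter.Tendsto
        (fun r : ℝ => ∑ α ∈ s, ENNReal.ofReal ((r ^ (∑ i, α i) * ‖coeff f α‖) ^ 2)) (𝓝[<] 1)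
        (𝓝 (∑ α ∈ s, ENNReal.ofReal (‖coeff f α‖ ^ 2))) := by
      refine tendsto_finsetSum _ fun α _ => ENNReal.tendsto_ofReal ?_
      have : Continuous fun r : ℝ => (r ^ (∑ i, α i) * ‖coeff f α‖) ^ 2 := by fun_prop
      simpa using (this.tendsto 1).mono_left nhdsWithin_le_nhds
    refine le_of_tendsto ht ?_
    filter_upwards [Ioo_mem_nhdsLT (show (0 : ℝ) < 1 by norm_num)] with r hr
    refine le_trans ?_ (le_iSup₂ (f := fun (r : ℝ) (_ : r ∈ Ioo (0 : ℝ) 1) =>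
      ∫⁻ t, ‖f ((r : ℂ) • torusPoint t)‖ₑ ^ 2 ∂torusMeasure d) r hr)
    rw [lintegral_radial hf hr]
    exact ENNReal.sum_le_tsum s

theorem series_zero {p : FormalMultilinearSeries ℂ (Fin d → ℂ) ℂ}
    (h : ∀ k n, multiCoeff p k n = 0) (k : ℕ) (w : Fin d → ℂ) : (p k fun _ => w) = 0 := by
  classical
  rw [series_word, ← Finset.sum_fiberwise_of_maps_to (s := Finset.univ)
    (t := Finset.univ.image fun v : Fin k → Fin d => cnt v) (g := fun v => cnt v)
    fun v hv => Finset.mem_image_of_mem _ hv]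
  refine Finset.sum_eq_zero fun α _ => ?_
  have h1 : ∀ v ∈ Finset.univ.filter (fun v : Fin k → Fin d => cnt v = α),
      wordCoeff p k v * ∏ i, w i ^ cnt v i = wordCoeff p k v * ∏ i, w i ^ α i := by
    intro v hv
    rw [(Finset.mem_filter.1 hv).2]
  rw [Finset.sum_congr rfl h1, ← Finset.sum_mul]
  have h2 := h k fun i => (α i : ℤ)
  rw [multiCoeff, ← Finset.sum_filter] at h2
  have h3 : (Finset.univ.filter fun v : Fin k → Fin d => cnt v = α) =
      Finset.univ.filter fun v : Fin k → Fin d =>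
        (fun i => (α i : ℤ)) = fun i => (cnt v i : ℤ) := by
    ext v
    simp only [Finset.mem_filter, Finset.mem_univ, true_and]
    exact ⟨fun hv => by rw [hv], fun hv => (castInt_injective hv).symm⟩
  rw [h3, h2, zero_mul]

theorem eq_zero_of_coeff {f : (Fin d → ℂ) → ℂ} (hf : AnalyticOnNhd ℂ f (polydisc d))
    (h : ∀ α, coeff f α = 0) {z : Fin d → ℂ} (hz : z ∈ polydisc d) : f z = 0 := by
  obtain ⟨p, hp⟩ := hf 0 (by intro i; simp)
  have h0 : ∀ k n, multiCoeff p k n = 0 := by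
    intro k n
    by_cases hn : ∃ α : Fin d → ℕ, n = (fun i => (α i : ℤ)) ∧ ∑ i, α i = k
    · obtain ⟨α, rfl, rfl⟩ := hn
      rw [← coeff_multi hf hp, h]
    · exact multiCoeff_eq_zero p k n hn
  rw [polydisc_eq_ball, mem_ball_zero_iff] at hz
  obtain ⟨r, hr1, hr2⟩ := exists_between hz
  obtain ⟨s, hs1, hs2⟩ := exists_between hr2
  have hr0 : 0 < r := (norm_nonneg z).trans_lt hr1
  obtain ⟨M, hM⟩ := slice hf hp (s := s) ⟨hr0.trans hs1, hs2⟩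
  have hrc : (r : ℂ) ≠ 0 := by exact_mod_cast hr0.ne'
  have h1 := (hM ((r : ℂ)⁻¹ • z) fun i => by
    have := (norm_le_pi_norm z i).trans hr1.le
    simp only [Pi.smul_apply, smul_eq_mul, norm_mul, norm_inv, Complex.norm_real, Real.norm_eq_abs,
      abs_of_pos hr0]
    rw [inv_mul_le_iff₀ hr0]
    linarith).2 r ⟨hr0, hs1⟩
  simp only [series_zero h0, mul_zero, smul_inv_smul₀ hrc] at h1
  exact h1.unique hasSum_zero

theorem summable_multi {r : ℝ} (h0 : 0 ≤ r) (h1 : r < 1) :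
    Summable fun α : Fin d → ℕ => r ^ (∑ i, α i) := by
  classical
  refine summable_of_sum_le (c := ∏ _i : Fin d, (1 - r)⁻¹) (fun α => by positivity) fun s => ?_
  have hs : s ⊆ Fintype.piFinset fun _ : Fin d =>
      Finset.range ((s.sup fun α => ∑ i, α i) + 1) := by
    intro α hα
    rw [Fintype.mem_piFinset]
    intro i
    rw [Finset.mem_range, Nat.lt_succ_iff]
    exact (Finset.single_le_sum (f := α) (fun _ _ => Nat.zero_le _) (Finset.mem_univ i)).trans
      (Finset.le_sup (f := fun α : Fin d → ℕ => ∑ i, α i) hα)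
  refine (Finset.sum_le_sum_of_subset_of_nonneg hs fun α _ _ => by positivity).trans ?_
  simp only [← Finset.prod_pow_eq_pow_sum]
  rw [← Finset.prod_univ_sum]
  refine Finset.prod_le_prod (fun i _ => Finset.sum_nonneg fun _ _ => by positivity) fun i _ => ?_
  rw [← tsum_geometric_of_lt_one h0 h1]
  exact (summable_geometric_of_lt_one h0 h1).sum_le_tsum _ fun _ _ => by positivity

theorem exists_word (α : Fin d → ℕ) :
    ∃ v : Fin (∑ i, α i) → Fin d, ∀ w : Fin d → ℂ, ∏ j, w (v j) = ∏ i, w i ^ α i := by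
  refine ⟨fun j => (finSigmaFinEquiv.symm j).1, fun w => ?_⟩
  rw [← Equiv.prod_comp finSigmaFinEquiv]
  simp only [Equiv.symm_apply_apply]
  rw [Fintype.prod_sigma]
  simp

theorem exists_multilinear (k : ℕ) (α : Fin d → ℕ) :
    ∃ m : ContinuousMultilinearMap ℂ (fun _ : Fin k => Fin d → ℂ) ℂ, ‖m‖ ≤ 1 ∧
      (∑ i, α i = k → ∀ w, (m fun _ => w) = ∏ i, w i ^ α i) := by
  by_cases h : ∑ i, α i = k
  · subst h
    obtain ⟨v, hv⟩ := exists_word α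
    refine ⟨(ContinuousMultilinearMap.mkPiAlgebraFin ℂ _ ℂ).compContinuousLinearMap
      fun j => ContinuousLinearMap.proj (v j), ?_, fun _ w => ?_⟩
    · refine (ContinuousMultilinearMap.norm_compContinuousLinearMap_le _ _).trans ?_
      rw [ContinuousMultilinearMap.norm_mkPiAlgebraFin, one_mul]
      refine Finset.prod_le_one (fun _ _ => norm_nonneg _) fun j _ => ?_
      refine ContinuousLinearMap.opNorm_le_bound _ zero_le_one fun z => ?_
      rw [one_mul]
      exact norm_le_pi_norm z (v j)
    · rw [← hv]
      simp [List.prod_ofFn]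
  · exact ⟨0, by simp, fun h' => absurd h' h⟩

/-- The function on the polydisc with given Taylor coefficients. -/
def powerSum (a : (Fin d → ℕ) → ℂ) : (Fin d → ℂ) → ℂ :=
  (polydisc d).indicator fun z => ∑' α, a α * ∏ i, z i ^ α i

theorem norm_monomial_le {z : Fin d → ℂ} {r : ℝ} (hz : ∀ i, ‖z i‖ ≤ r) (α : Fin d → ℕ) :
    ‖∏ i, z i ^ α i‖ ≤ r ^ (∑ i, α i) := by
  rw [norm_prod, ← Finset.prod_pow_eq_pow_sum]
  refine Finset.prod_le_prod (fun _ _ => norm_nonneg _) fun i _ => ?_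
  rw [norm_pow]
  gcongr
  exact hz i

theorem powerSum_analytic {a : (Fin d → ℕ) → ℂ} {C : ℝ} (ha : ∀ α, ‖a α‖ ≤ C) :
    AnalyticOnNhd ℂ (powerSum a) (polydisc d) := by
  classical
  choose m hm1 hm2 using exists_multilinear (d := d)
  have hC : 0 ≤ C := (norm_nonneg _).trans (ha 0)
  let p : FormalMultilinearSeries ℂ (Fin d → ℂ) ℂ := fun k =>
    ∑ α ∈ Finset.piAntidiag Finset.univ k, a α • m k α
  have hmem : ∀ k (α : Fin d → ℕ), α ∈ Finset.piAntidiag Finset.univ k ↔ ∑ i, α i = k := by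
    intro k α
    simp [Finset.mem_piAntidiag]
  let e : (Σ k, {α : Fin d → ℕ // α ∈ Finset.piAntidiag Finset.univ k}) ≃ (Fin d → ℕ) :=
    { toFun := fun x => x.2.1
      invFun := fun α => ⟨∑ i, α i, α, (hmem _ _).2 rfl⟩
      left_inv := by
        rintro ⟨k, α, hα⟩
        obtain rfl := (hmem _ _).1 hα
        rfl
      right_inv := fun α => rfl }
  have group : ∀ {E : Type} [NormedAddCommGroup E] [CompleteSpace E] {g : (Fin d → ℕ) → E} {x : E},
      HasSum g x → HasSum (fun k => ∑ α ∈ Finset.piAntidiag Finset.univ k, g α) x := by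
    intro E _ _ g x hg
    have h1 := (e.hasSum_iff (f := g)).2 hg
    exact h1.sigma fun k => Finset.hasSum _ g
  have hps : ∀ z ∈ polydisc d, HasSum (fun k => p k fun _ => z) (powerSum a z) := by
    intro z hz
    have hz' := hz
    rw [polydisc_eq_ball, mem_ball_zero_iff] at hz'
    have hsum : Summable fun α : Fin d → ℕ => a α * ∏ i, z i ^ α i := by
      refine Summable.of_norm_bounded ((summable_multi (norm_nonneg z) hz').mul_left C) fun α => ?_
      rw [norm_mul]
      exact mul_le_mul (ha α) (norm_monomial_le (norm_le_pi_norm z) α) (norm_nonneg _) hC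
    have h1 := group hsum.hasSum
    rw [powerSum, indicator_of_mem hz]
    refine h1.congr_fun fun k => ?_
    simp only [p, sum_apply, smul_apply,
      smul_eq_mul]
    refine Finset.sum_congr rfl fun α hα => ?_
    rw [hm2 k α ((hmem k α).1 hα)]
  have hball : HasFPowerSeriesOnBall (powerSum a) p 0 1 := by
    refine ⟨ENNReal.le_of_forall_nnreal_lt fun r hr => ?_, zero_lt_one, fun {y} hy => ?_⟩
    · have hr1 : (r : ℝ) < 1 := by exact_mod_cast hr
      refine p.le_radius_of_summable ?_
      have h1 := group ((summable_multi (d := d) r.2 hr1).mul_left C).hasSum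
      refine Summable.of_nonneg_of_le (fun k => by positivity) (fun k => ?_) h1.summable
      rw [← Finset.mul_sum]
      have h2 : ∀ α ∈ Finset.piAntidiag (Finset.univ : Finset (Fin d)) k,
          (r : ℝ) ^ (∑ i, α i) = r ^ k := fun α hα => by rw [(hmem k α).1 hα]
      have h3 : ‖p k‖ ≤ ∑ α ∈ Finset.piAntidiag (Finset.univ : Finset (Fin d)) k, C := by
        refine (norm_sum_le _ _).trans (Finset.sum_le_sum fun α _ => ?_)
        rw [norm_smul]
        have := hm1 k α
        nlinarith [ha α, norm_nonneg (a α), norm_nonneg (m k α)]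
      change ‖p k‖ * (r : ℝ) ^ k ≤ C * ∑ α ∈ Finset.piAntidiag Finset.univ k, (r : ℝ) ^ (∑ i, α i)
      rw [Finset.sum_congr rfl h2, Finset.mul_sum, ← Finset.sum_mul]
      exact mul_le_mul_of_nonneg_right h3 (by positivity)
    · rw [zero_add]
      refine hps y ?_
      rw [polydisc_eq_ball, ← Metric.eball_ofReal]
      simpa using hy
  have h := hball.analyticOnNhd
  rw [← ENNReal.ofReal_one, Metric.eball_ofReal, ← polydisc_eq_ball] at h
  exact h

theorem coeff_powerSum {a : (Fin d → ℕ) → ℂ} {C : ℝ} (ha : ∀ α, ‖a α‖ ≤ C) (α : Fin d → ℕ) :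
    coeff (powerSum a) α = a α := by
  have hC : 0 ≤ C := (norm_nonneg _).trans (ha 0)
  have hr := half_mem
  set F : (Fin d → ℕ) → (Fin d → UnitAddCircle) → ℂ := fun β t =>
    UnitAddTorus.mFourier (-fun i => (α i : ℤ)) t *
      (((1 / 2 : ℝ) : ℂ) ^ (∑ i, β i) * a β * UnitAddTorus.mFourier (fun i => (β i : ℤ)) t)
    with hF
  have hnorm : ∀ (n : Fin d → ℤ) t, ‖UnitAddTorus.mFourier n t‖ ≤ 1 := fun n t =>
    (ContinuousMap.norm_coe_le_norm _ t).trans UnitAddTorus.mFourier_norm.le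
  have hb : ∀ β t, ‖F β t‖ ≤ C * (1 / 2 : ℝ) ^ (∑ i, β i) := by
    intro β t
    simp only [hF, norm_mul, norm_pow, Complex.norm_real, Real.norm_eq_abs, abs_of_pos hr.1]
    have h1 := hnorm (-fun i => (α i : ℤ)) t
    have h2 := hnorm (fun i => (β i : ℤ)) t
    have h3 := ha β
    calc _ ≤ 1 * ((1 / 2 : ℝ) ^ (∑ i, β i) * C * 1) := by gcongr
      _ = _ := by ring
  have hint : ∀ β, Integrable (F β) (torusMeasure d) := fun β =>
    ((UnitAddTorus.mFourier _).continuous.mul (continuous_const.mul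
      (UnitAddTorus.mFourier _).continuous)).integrable_of_hasCompactSupport
      (HasCompactSupport.of_compactSpace _)
  have hsum := (summable_multi (d := d) hr.1.le hr.2).mul_left C
  have h4 := hasSum_integral_of_summable_integral_norm (F := F) hint (by
    refine Summable.of_nonneg_of_le (fun k => integral_nonneg fun t => norm_nonneg _)
      (fun β => ?_) hsum
    refine (integral_mono (hint β).norm (integrable_const (C * (1 / 2 : ℝ) ^ (∑ i, β i)))
      (hb β)).trans ?_
    simp)
  have h5 : (∫ t, ∑' β, F β t ∂torusMeasure d) = fc (powerSum a) (1 / 2) fun i => (α i : ℤ) := by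
    refine integral_congr_ae (Filter.Eventually.of_forall fun t => ?_)
    simp only [hF]
    rw [tsum_mul_left, powerSum, indicator_of_mem (radial_mem _ hr t)]
    congr 1
    refine tsum_congr fun β => ?_
    rw [← monomial_torus, ← Finset.prod_pow_eq_pow_sum]
    simp only [Pi.smul_apply, smul_eq_mul, mul_pow, Finset.prod_mul_distrib]
    ring
  rw [h5] at h4
  have h6 : ∀ β, ∫ t, F β t ∂torusMeasure d =
      if α = β then ((1 / 2 : ℝ) : ℂ) ^ (∑ i, α i) * a α else 0 := by
    intro β
    have : ∀ t, F β t = (((1 / 2 : ℝ) : ℂ) ^ (∑ i, β i) * a β) *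
        (UnitAddTorus.mFourier (-fun i => (α i : ℤ)) t *
          UnitAddTorus.mFourier (fun i => (β i : ℤ)) t) := fun t => by simp only [hF]; ring
    simp only [this]
    rw [integral_const_mul, orth]
    by_cases h : α = β
    · subst h; simp
    · rw [if_neg h, if_neg fun h' => h (castInt_injective h'), mul_zero]
  simp only [h6] at h4
  have h7 := h4.unique (hasSum_single α fun β hβ => if_neg (Ne.symm hβ))
  rw [coeff, h7, if_pos rfl, ← mul_assoc, ← mul_pow]
  norm_num

theorem fc_add {f g : (Fin d → ℂ) → ℂ} (hf : AnalyticOnNhd ℂ f (polydisc d))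
    (hg : AnalyticOnNhd ℂ g (polydisc d)) {r : ℝ} (hr : r ∈ Ioo (0 : ℝ) 1) (n : Fin d → ℤ) :
    fc (f + g) r n = fc f r n + fc g r n := by
  have h : ∀ {k : (Fin d → ℂ) → ℂ}, AnalyticOnNhd ℂ k (polydisc d) → Integrable (fun t =>
      UnitAddTorus.mFourier (-n) t * k ((r : ℂ) • torusPoint t)) (torusMeasure d) := fun hk =>
    ((UnitAddTorus.mFourier (-n)).continuous.mul
      (continuous_radial hk hr)).integrable_of_hasCompactSupport (HasCompactSupport.of_compactSpace _)
  simp only [fc, Pi.add_apply, mul_add]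
  exact integral_add (h hf) (h hg)

theorem coeff_add {f g : (Fin d → ℂ) → ℂ} (hf : AnalyticOnNhd ℂ f (polydisc d))
    (hg : AnalyticOnNhd ℂ g (polydisc d)) (α : Fin d → ℕ) :
    coeff (f + g) α = coeff f α + coeff g α := by
  rw [coeff, fc_add hf hg half_mem, mul_add]; rfl

theorem coeff_smul (c : ℂ) (f : (Fin d → ℂ) → ℂ) (α : Fin d → ℕ) :
    coeff (c • f) α = c * coeff f α := by
  simp only [coeff, fc, Pi.smul_apply, smul_eq_mul, mul_left_comm _ c]
  rw [integral_const_mul]; ring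

theorem hardySq_add_lt {f g : (Fin d → ℂ) → ℂ} (hf : AnalyticOnNhd ℂ f (polydisc d))
    (h1 : hardySq f < ∞) (h2 : hardySq g < ∞) : hardySq (f + g) < ∞ := by
  have : hardySq (f + g) ≤ 2 * hardySq f + 2 * hardySq g := by
    refine iSup₂_le fun r hr => ?_
    have hle : ∀ t, ‖(f + g) ((r : ℂ) • torusPoint t)‖ₑ ^ 2 ≤
        2 * ‖f ((r : ℂ) • torusPoint t)‖ₑ ^ 2 + 2 * ‖g ((r : ℂ) • torusPoint t)‖ₑ ^ 2 := by
      intro t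
      generalize hx : f ((r : ℂ) • torusPoint t) = x
      generalize hy : g ((r : ℂ) • torusPoint t) = y
      rw [Pi.add_apply, hx, hy]
      simp only [enorm_eq_nnnorm]
      norm_cast
      rw [← NNReal.coe_le_coe]
      push_cast
      have := norm_add_le x y
      nlinarith [sq_nonneg (‖x‖ - ‖y‖), norm_nonneg (x + y), norm_nonneg x, norm_nonneg y]
    refine (lintegral_mono hle).trans ?_
    rw [lintegral_add_left' (((continuous_radial hf hr).enorm.aemeasurable.pow_const 2).const_mul 2),
      lintegral_const_mul' _ _ (by simp), lintegral_const_mul' _ _ (by simp)]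
    gcongr
    · exact le_iSup₂ (f := fun (r : ℝ) (_ : r ∈ Ioo (0 : ℝ) 1) =>
        ∫⁻ t, ‖f ((r : ℂ) • torusPoint t)‖ₑ ^ 2 ∂torusMeasure d) r hr
    · exact le_iSup₂ (f := fun (r : ℝ) (_ : r ∈ Ioo (0 : ℝ) 1) =>
        ∫⁻ t, ‖g ((r : ℂ) • torusPoint t)‖ₑ ^ 2 ∂torusMeasure d) r hr
  refine this.trans_lt (ENNReal.add_lt_top.2 ⟨?_, ?_⟩)
  · exact ENNReal.mul_lt_top (by simp) h1
  · exact ENNReal.mul_lt_top (by simp) h2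

theorem hardySq_mul_le {f g : (Fin d → ℂ) → ℂ} {C : ℝ≥0} (hg : ∀ z ∈ polydisc d, ‖g z‖ ≤ C) :
    hardySq (fun z => g z * f z) ≤ (C : ℝ≥0∞) ^ 2 * hardySq f := by
  refine iSup₂_le fun r hr => ?_
  have hle : ∀ t, ‖g ((r : ℂ) • torusPoint t) * f ((r : ℂ) • torusPoint t)‖ₑ ^ 2 ≤
      (C : ℝ≥0∞) ^ 2 * ‖f ((r : ℂ) • torusPoint t)‖ₑ ^ 2 := by
    intro t
    rw [enorm_mul, mul_pow]
    gcongr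
    rw [enorm_eq_nnnorm]
    exact_mod_cast hg _ (radial_mem r hr t)
  refine (lintegral_mono hle).trans ?_
  rw [lintegral_const_mul' _ _ (by simp)]
  gcongr
  exact le_iSup₂ (f := fun (r : ℝ) (_ : r ∈ Ioo (0 : ℝ) 1) =>
        ∫⁻ t, ‖f ((r : ℂ) • torusPoint t)‖ₑ ^ 2 ∂torusMeasure d) r hr

/-- The functions of the Hardy space, as a subspace of all functions. -/
def hardySubmodule (d : ℕ) : Submodule ℂ ((Fin d → ℂ) → ℂ) where
  carrier := {f | AnalyticOnNhd ℂ f (polydisc d) ∧ (∀ z ∉ polydisc d, f z = 0) ∧ hardySq f < ∞}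
  add_mem' := by
    rintro f g ⟨hf1, hf2, hf3⟩ ⟨hg1, hg2, hg3⟩
    exact ⟨hf1.add hg1, fun z hz => by simp [hf2 z hz, hg2 z hz], hardySq_add_lt hf1 hf3 hg3⟩
  zero_mem' := ⟨analyticOnNhd_const, fun _ _ => rfl, by simp [hardySq]⟩
  smul_mem' := by
    rintro c f ⟨hf1, hf2, hf3⟩
    refine ⟨analyticOnNhd_const.mul hf1, fun z hz => by simp [hf2 z hz], ?_⟩
    refine (hardySq_mul_le (f := f) (g := fun _ => c) (C := ‖c‖₊) fun _ _ => le_rfl).trans_lt ?_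
    exact ENNReal.mul_lt_top (by simp) hf3

/-- The Hardy space over the polydisc: the analytic functions on the polydisc with finite Hardy
norm. A function on the polydisc is represented by its extension by zero to `ℂ ^ d`. -/
structure HardySpace (d : ℕ) where
  /-- The underlying function. -/
  toFun : (Fin d → ℂ) → ℂ
  analytic : AnalyticOnNhd ℂ toFun (polydisc d)
  eq_zero : ∀ z ∉ polydisc d, toFun z = 0
  finite : hardySq toFun < ∞

/-- The Hardy space as a subspace of all functions. -/
def hardyEquiv (d : ℕ) : HardySpace d ≃ hardySubmodule d where
  toFun f := ⟨f.toFun, f.analytic, f.eq_zero, f.finite⟩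
  invFun f := ⟨f.1, f.2.1, f.2.2.1, f.2.2.2⟩

/-- Pointwise addition. -/
instance : AddCommGroup (HardySpace d) := (hardyEquiv d).addCommGroup

/-- Pointwise scalar multiplication. -/
instance : Module ℂ (HardySpace d) := (hardyEquiv d).module ℂ

theorem HardySpace.toFun_add (f g : HardySpace d) : (f + g).toFun = f.toFun + g.toFun := rfl

theorem HardySpace.toFun_smul (c : ℂ) (f : HardySpace d) : (c • f).toFun = c • f.toFun := rfl

theorem HardySpace.toFun_zero : (0 : HardySpace d).toFun = 0 := rfl

theorem HardySpace.toFun_injective :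
    Function.Injective (HardySpace.toFun : HardySpace d → (Fin d → ℂ) → ℂ) := by
  rintro ⟨f, _, _, _⟩ ⟨g, _, _, _⟩ h
  cases h
  rfl

theorem HardySpace.ext_on {f g : HardySpace d} (h : ∀ z ∈ polydisc d, f.toFun z = g.toFun z) : f = g := by
  refine HardySpace.toFun_injective (funext fun z => ?_)
  by_cases hz : z ∈ polydisc d
  · exact h z hz
  · rw [f.eq_zero z hz, g.eq_zero z hz]

/-- The Hardy norm. -/
instance : Norm (HardySpace d) := ⟨fun f => √(hardySq f.toFun).toReal⟩

theorem HardySpace.norm_def (f : HardySpace d) : ‖f‖ = √(hardySq f.toFun).toReal := rfl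

theorem HardySpace.hasSum_coeff (f : HardySpace d) :
    HasSum (fun α => ‖coeff f.toFun α‖ ^ 2) (‖f‖ ^ 2) := by
  have h1 := hardySq_eq f.analytic
  have h2 : hardySq f.toFun ≠ ∞ := f.finite.ne
  rw [h1] at h2
  have h3 : Summable fun α => ‖coeff f.toFun α‖ ^ 2 := by
    have := ENNReal.summable_toReal h2
    refine this.congr fun α => ?_
    rw [ENNReal.toReal_ofReal (by positivity)]
  have h4 : ‖f‖ ^ 2 = ∑' α, ‖coeff f.toFun α‖ ^ 2 := by
    rw [HardySpace.norm_def, Real.sq_sqrt ENNReal.toReal_nonneg, h1,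
      ← ENNReal.ofReal_tsum_of_nonneg (fun α => by positivity) h3,
      ENNReal.toReal_ofReal (tsum_nonneg fun α => by positivity)]
  rw [h4]
  exact h3.hasSum

/-- The space of square summable families indexed by multi-indices. -/
abbrev CoeffSpace (d : ℕ) : Type := lp (fun _ : Fin d → ℕ => ℂ) 2

/-- The map to Taylor coefficients. -/
def taylor (d : ℕ) : HardySpace d →ₗ[ℂ] CoeffSpace d where
  toFun f := ⟨fun α => coeff f.toFun α, by
    refine memℓp_gen ?_
    simpa using f.hasSum_coeff.summable⟩
  map_add' f g := by
    ext α
    exact coeff_add f.analytic g.analytic α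
  map_smul' c f := by
    ext α
    exact coeff_smul c f.toFun α

theorem norm_taylor (f : HardySpace d) : ‖taylor d f‖ = ‖f‖ := by
  have h : ‖taylor d f‖ ^ 2 = ‖f‖ ^ 2 := by
    have h1 := lp.norm_rpow_eq_tsum (p := 2) (by simp) (taylor d f)
    simp only [ENNReal.toReal_ofNat, Real.rpow_ofNat] at h1
    rw [h1]
    exact f.hasSum_coeff.tsum_eq
  exact (sq_eq_sq₀ (norm_nonneg _) (Real.sqrt_nonneg _)).1 h

theorem taylor_injective : Function.Injective (taylor d) := by
  rw [← LinearMap.ker_eq_bot, LinearMap.ker_eq_bot']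
  intro f hf
  refine HardySpace.ext_on fun z hz => ?_
  refine eq_zero_of_coeff f.analytic (fun α => ?_) hz
  exact congrFun (congrArg Subtype.val hf) α

theorem taylor_surjective : Function.Surjective (taylor d) := by
  intro a
  have ha : ∀ α, ‖a.1 α‖ ≤ ‖a‖ := fun α => lp.norm_apply_le_norm (by simp) a α
  have h1 := powerSum_analytic ha
  refine ⟨⟨powerSum a.1, h1, fun z hz => indicator_of_notMem hz _, ?_⟩, ?_⟩
  · rw [hardySq_eq h1]
    simp only [coeff_powerSum ha]
    have h2 := (lp.memℓp a).summable (by simp)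
    simp only [ENNReal.toReal_ofNat, Real.rpow_ofNat] at h2
    rw [← ENNReal.ofReal_tsum_of_nonneg (fun α => by positivity) h2]
    exact ENNReal.ofReal_lt_top
  · ext α
    exact coeff_powerSum ha α

theorem hardy_core : NormedSpace.Core ℂ (HardySpace d) where
  norm_nonneg f := Real.sqrt_nonneg _
  norm_smul c f := by simp only [← norm_taylor, map_smul, norm_smul]
  norm_triangle f g := by
    simp only [← norm_taylor, map_add]
    exact norm_add_le _ _
  norm_eq_zero_iff f := by
    rw [← norm_taylor, norm_eq_zero, map_eq_zero_iff _ taylor_injective]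

instance : NormedAddCommGroup (HardySpace d) := NormedAddCommGroup.ofCore hardy_core

instance : NormedSpace ℂ (HardySpace d) := NormedSpace.ofCore hardy_core

/-- The inner product which induces the Hardy norm, computed with Taylor coefficients. -/
instance : InnerProductSpace ℂ (HardySpace d) where
  inner f g := inner ℂ (taylor d f) (taylor d g)
  norm_sq_eq_re_inner f := by
    rw [← norm_taylor]
    exact norm_sq_eq_re_inner (𝕜 := ℂ) _
  conj_inner_symm f g := inner_conj_symm _ _
  add_left f g h := by rw [map_add, inner_add_left]
  smul_left f g c := by rw [map_smul, inner_smul_left]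

/-- The Hardy space is isometric to the space of square summable Taylor coefficients. -/
def taylorEquiv (d : ℕ) : HardySpace d ≃ₗᵢ[ℂ] CoeffSpace d :=
  { LinearEquiv.ofBijective (taylor d) ⟨taylor_injective, taylor_surjective⟩ with
    norm_map' := norm_taylor }

instance : CompleteSpace (HardySpace d) :=
  (completeSpace_congr (e := (taylorEquiv d).toEquiv) (taylorEquiv d).isometry.isUniformEmbedding).2 inferInstance

theorem exists_poly_bound (q : MvPolynomial (Fin d) ℂ) :
    ∃ C : ℝ≥0, ∀ z ∈ polydisc d, ‖MvPolynomial.eval z q‖ ≤ C := by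
  have hK : IsCompact (Metric.closedBall (0 : Fin d → ℂ) 1) := isCompact_closedBall _ _
  obtain ⟨C, hC⟩ := hK.exists_bound_of_continuousOn (f := fun z => MvPolynomial.eval z q)
    (MvPolynomial.continuous_eval q).continuousOn
  refine ⟨C.toNNReal, fun z hz => ?_⟩
  rw [polydisc_eq_ball] at hz
  exact (hC z (Metric.ball_subset_closedBall hz)).trans (Real.le_coe_toNNReal C)

theorem analytic_poly (q : MvPolynomial (Fin d) ℂ) :
    AnalyticOnNhd ℂ (fun z : Fin d → ℂ => MvPolynomial.eval z q) (polydisc d) := by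
  have := AnalyticOnNhd.aeval_mvPolynomial (𝕜 := ℂ) (f := fun z : Fin d → ℂ => z)
    (s := polydisc d) (fun i z _ => (ContinuousLinearMap.proj (R := ℂ) (φ := fun _ : Fin d => ℂ) i).analyticAt z) q
  simpa [MvPolynomial.aeval_eq_eval] using this

/-- The multiplication operator by a polynomial, as a linear map. -/
def mulPolyₗ (q : MvPolynomial (Fin d) ℂ) : HardySpace d →ₗ[ℂ] HardySpace d where
  toFun f := ⟨fun z => MvPolynomial.eval z q * f.toFun z, (analytic_poly q).mul f.analytic,
    fun z hz => by simp [f.eq_zero z hz], by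
      obtain ⟨C, hC⟩ := exists_poly_bound q
      exact (hardySq_mul_le hC).trans_lt (ENNReal.mul_lt_top (by simp) f.finite)⟩
  map_add' f g := HardySpace.toFun_injective (funext fun z => mul_add _ _ _)
  map_smul' c f := HardySpace.toFun_injective (funext fun z => mul_left_comm _ _ _)

/-- The multiplication operator `M_q` by a polynomial `q`. -/
def mulPoly (q : MvPolynomial (Fin d) ℂ) : HardySpace d →L[ℂ] HardySpace d where
  toLinearMap := mulPolyₗ q
  cont := by
    obtain ⟨C, hC⟩ := exists_poly_bound q
    refine AddMonoidHomClass.continuous_of_bound (mulPolyₗ q) C fun f => ?_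
    have hC2 : (C : ℝ) = √((C : ℝ) ^ 2) := (Real.sqrt_sq C.2).symm
    rw [HardySpace.norm_def, HardySpace.norm_def, hC2, ← Real.sqrt_mul (sq_nonneg _)]
    refine Real.sqrt_le_sqrt ?_
    have h := ENNReal.toReal_mono (ENNReal.mul_lt_top (by simp) f.finite).ne
      (hardySq_mul_le (f := f.toFun) hC)
    rw [ENNReal.toReal_mul] at h
    simp only [ENNReal.toReal_pow, ENNReal.coe_toReal] at h
    exact h

/-- A polynomial as an element of the Hardy space. -/
def ofPoly (d : ℕ) : MvPolynomial (Fin d) ℂ →ₗ[ℂ] HardySpace d where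
  toFun q := ⟨(polydisc d).indicator fun z => MvPolynomial.eval z q,
    (analytic_poly q).congr isOpen_polydisc fun z hz => (indicator_of_mem (f := fun z => MvPolynomial.eval z q) hz).symm,
    fun z hz => indicator_of_notMem hz _, by
      obtain ⟨C, hC⟩ := exists_poly_bound q
      refine lt_of_le_of_lt (iSup₂_le fun r hr => ?_) (show (C : ℝ≥0∞) ^ 2 < ∞ by simp)
      refine (lintegral_mono (g := fun _ => (C : ℝ≥0∞) ^ 2) fun t => ?_).trans (by simp)
      simp only
      rw [indicator_of_mem (radial_mem r hr t), enorm_eq_nnnorm]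
      gcongr
      exact_mod_cast hC _ (radial_mem r hr t)⟩
  map_add' p q := HardySpace.ext_on fun z hz => by
    simp [HardySpace.toFun_add, indicator_of_mem hz]
  map_smul' c q := HardySpace.ext_on fun z hz => by
    simp [HardySpace.toFun_smul, indicator_of_mem hz]

/-- The submodule `[I]` generated by an ideal `I`: the closure of `I` in the Hardy space. -/
def closedSubmodule (I : Ideal (MvPolynomial (Fin d) ℂ)) : Submodule ℂ (HardySpace d) :=
  ((I.restrictScalars ℂ).map (ofPoly d)).topologicalClosure

/-- The quotient module `[I]ᗮ` associated to an ideal `I`. -/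
abbrev quotientModule (I : Ideal (MvPolynomial (Fin d) ℂ)) : Submodule ℂ (HardySpace d) :=
  (closedSubmodule I)ᗮ

/-- The compression `S_q = P_N M_q |_N` of multiplication by `q` to a subspace `N`. -/
def compression (N : Submodule ℂ (HardySpace d)) [N.HasOrthogonalProjection]
    (q : MvPolynomial (Fin d) ℂ) : N →L[ℂ] N :=
  N.orthogonalProjectionOnto ∘L mulPoly q ∘L N.subtypeL

/-- `N` is essentially normal: all the commutators `[S_{z_i}^*, S_{z_j}]` are compact. -/
def IsEssentiallyNormal (N : Submodule ℂ (HardySpace d)) [N.HasOrthogonalProjection]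
    [CompleteSpace N] : Prop :=
  ∀ i j : Fin d,
    IsCompactOperator
      (ContinuousLinearMap.adjoint (compression N (MvPolynomial.X i)) ∘L
          compression N (MvPolynomial.X j) -
        compression N (MvPolynomial.X j) ∘L
          ContinuousLinearMap.adjoint (compression N (MvPolynomial.X i)))

/-- `A` is essentially unitary: `1 - A A^*` and `1 - A^* A` are compact. -/
def IsEssentiallyUnitary {H₁ H₂ : Type*} [NormedAddCommGroup H₁] [InnerProductSpace ℂ H₁]
    [CompleteSpace H₁] [NormedAddCommGroup H₂] [InnerProductSpace ℂ H₂] [CompleteSpace H₂]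
    (A : H₁ →L[ℂ] H₂) : Prop :=
  IsCompactOperator
      (ContinuousLinearMap.id ℂ H₂ - A ∘L ContinuousLinearMap.adjoint A) ∧
    IsCompactOperator
      (ContinuousLinearMap.id ℂ H₁ - ContinuousLinearMap.adjoint A ∘L A)

/-- The disc `V_u = {λ u : |λ| < 1}`. -/
def disc (u : Fin d → ℂ) : Set (Fin d → ℂ) := {z | ∃ l : ℂ, ‖l‖ < 1 ∧ z = l • u}

/-- The ideal `J_u` generated by `conj (u i) z_i - conj (u j) z_j` for `|u i| = |u j| = 1`. -/
def unimodularIdeal (u : Fin d → ℂ) : Ideal (MvPolynomial (Fin d) ℂ) :=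
  Ideal.span {q | ∃ i j : Fin d, ‖u i‖ = 1 ∧ ‖u j‖ = 1 ∧
    q = MvPolynomial.C (conj (u i)) * MvPolynomial.X i -
      MvPolynomial.C (conj (u j)) * MvPolynomial.X j}

attribute [local instance] MvPolynomial.gradedAlgebra

/-- `I` is an essentially quasi-prime homogeneous ideal with variety `V_u`: it is homogeneous, its
zero set in the polydisc is `V_u`, and `√I / (I + J_u)` is finite-dimensional. -/
structure IsEssentiallyQuasiPrime (u : Fin d → ℂ) (I : Ideal (MvPolynomial (Fin d) ℂ)) : Prop where
  homogeneous : I.IsHomogeneous (MvPolynomial.homogeneousSubmodule (Fin d) ℂ)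
  variety : MvPolynomial.zeroLocus ℂ I ∩ polydisc d = disc u
  finite_quotient : Module.Finite ℂ
    (I.radical.restrictScalars ℂ ⧸
      ((I ⊔ unimodularIdeal u).restrictScalars ℂ).submoduleOf (I.radical.restrictScalars ℂ))

end PolydiscHardy

end

open PolydiscHardy

/-!
Let `T j` be multiplication by `z j` on the Hardy space and `N = [I]ᗮ`. Choose `j` with `|u j| = 1`.
The theorem reduces to two facts: the compression `S j` of `T j` to `N` is essentially unitary, and
the compression of `z i - u i conj (u j) z j` is compact for each `i`. Then `S = conj (u j) S j` is
as required, and essential normality follows since adjoints of compact operators are compact.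

*Essential coisometry.* As `I` is homogeneous, its zero set is the line spanned by `u`, and by the
Nullstellensatz a power of each linear form `z l - u l conj (u j) z j` lies in `I`. Dually, a power
of `T l† - c T j†`, where `|c| ≤ 1`, annihilates `N`: the Taylor coefficients of a function in `N`
satisfy in the direction `(l, j)` a linear recurrence with characteristic root in the closed disc.
Let `Y` be the mean of the powers `X ^ t`, `t < M`, of `X = c T l T j†`. For `f ∈ N` and suitable
`m` the coefficients of `(1 - Y) ^ m f` vanish at the indices whose `l`-th entry is large, so that `f`
can be replaced there by `f - (1 - Y) ^ m f`, which is a multiple of `Y`. The projection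
`1 - T j T j†` onto the functions not depending on `z j` takes the terms of `Y g` to vectors which
are bounded by mutually orthogonal pieces of `g`, and therefore `(1 - T j T j†) Y` has norm at most
`1 / √M` (`norm_star_pow_one_sub_mul_star_le`). Hence the coefficients of `(1 - T j T j†) f`,
`f ∈ N`, are uniformly small outside a finite set of indices, so that `1 - T j T j†` is compact on `N`
(`isCompactOperator_one_sub_shift_mul_star`); its compression is `1 - S j S j†`.

*Essential unitarity.* `N` is graded by the degree, and `S j†` lowers the degree by one. In high
degree it is almost isometric, hence injective, so that the dimensions of the graded parts decrease.
They become constant, `S j†` becomes bijective between successive parts, and `S j` is almost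
isometric as well (`IsGrading.isCompactOperator_one_sub_star_mul`).

*Differences.* If `|u i| = 1` too, the classes of `S i` and `u i conj (u j) S j` in the Calkin
algebra are commuting unitaries; their difference is normal and nilpotent, hence zero. Therefore
the ideal of the polynomials with compact compression contains `I + J_u`. For arbitrary `i`, the
finiteness of the dimension of `√I / (I + J_u)` puts a product of a power of `z j` with
`z i - u i conj (u j) z j` in `I + J_u`, and the power of `S j` can be cancelled in the Calkin
algebra.
-/

/-! ### Compact operators on Hilbert spaces -/

section CompactOperators

open ContinuousLinearMap

variable {H G : Type*} [NormedAddCommGroup H] [InnerProductSpace ℂ H]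
  [NormedAddCommGroup G] [InnerProductSpace ℂ G]

/-- The estimate `‖T x - T y‖ ^ 2 ≤ ‖T† T (x - y)‖ * ‖x - y‖` transports a finite net of the image
of the unit ball under `T† T` to one of its image under `T`. -/
theorem isCompactOperator_of_adjoint_comp_self [CompleteSpace H] [CompleteSpace G]
    {T : H →L[ℂ] G}
    (h : IsCompactOperator (adjoint T ∘L T)) : IsCompactOperator T := by
  rw [← ContinuousLinearMap.coe_coe,
    isCompactOperator_iff_isCompact_closure_image_closedBall (T : H →ₗ[ℂ] G) zero_lt_one]
  have h1 := h.isCompact_closure_image_closedBall (𝕜₁ := ℂ)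
    (f := ((adjoint T ∘L T : H →L[ℂ] H) : H →ₗ[ℂ] H)) 1
  have h2 := h1.totallyBounded.subset subset_closure
  refine TotallyBounded.isCompact_of_isClosed (TotallyBounded.closure ?_) isClosed_closure
  rw [Metric.totallyBounded_iff]
  intro ε hε
  obtain ⟨t, hts, ht, hcov⟩ := exists_subset_image_finite_and.1
    (Metric.finite_approx_of_totallyBounded h2 (ε ^ 2 / 4) (by positivity))
  refine ⟨T '' t, ht.image _, ?_⟩
  rintro _ ⟨x, hx, rfl⟩
  have h3 := hcov ⟨x, hx, rfl⟩
  simp only [biUnion_image, mem_iUnion, Metric.mem_ball, exists_prop] at h3 ⊢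
  obtain ⟨y, hy, hxy⟩ := h3
  refine ⟨y, hy, ?_⟩
  have h4 : ‖adjoint T (T (x - y))‖ < ε ^ 2 / 4 := by
    rw [map_sub, map_sub, ← dist_eq_norm]
    exact hxy
  have h5 : ‖x - y‖ ≤ 2 := by
    rw [mem_closedBall_zero_iff] at hx
    have h6 := mem_closedBall_zero_iff.1 (hts hy)
    linarith [norm_sub_le x y]
  have h6 : ‖T (x - y)‖ ^ 2 ≤ ‖adjoint T (T (x - y))‖ * ‖x - y‖ := by
    rw [apply_norm_sq_eq_inner_adjoint_left]
    exact (Complex.re_le_norm _).trans (norm_inner_le_norm _ _)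
  have h7 : ‖T (x - y)‖ ^ 2 < ε ^ 2 := by
    nlinarith [norm_nonneg (adjoint T (T (x - y))), norm_nonneg (x - y), sq_pos_of_pos hε]
  change dist (T x) (T y) < ε
  rw [dist_eq_norm, ← map_sub]
  exact lt_of_pow_lt_pow_left₀ 2 hε.le h7

/-- Schauder's theorem for Hilbert spaces. -/
theorem IsCompactOperator.adjoint [CompleteSpace H] [CompleteSpace G]
    {T : H →L[ℂ] G} (h : IsCompactOperator T) :
    IsCompactOperator (adjoint T) := by
  apply isCompactOperator_of_adjoint_comp_self
  rw [adjoint_adjoint]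
  exact h.comp_clm _

theorem isCompactOperator_of_approx [CompleteSpace G] {T : H →L[ℂ] G}
    (h : ∀ ε > 0, ∃ F : H →L[ℂ] G, IsCompactOperator F ∧ ‖T - F‖ ≤ ε) : IsCompactOperator T := by
  choose F hF1 hF2 using fun n : ℕ => h (1 / ((n : ℝ) + 1)) (by positivity)
  refine isCompactOperator_of_tendsto (l := Filter.atTop) (F := F) ?_
    (Filter.Eventually.of_forall hF1)
  rw [tendsto_iff_norm_sub_tendsto_zero]
  refine squeeze_zero (fun _ => norm_nonneg _) (fun n => ?_) tendsto_one_div_add_atTop_nhds_zero_nat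
  rw [norm_sub_rev]
  exact hF2 n

variable (H) in
/-- The ideal of compact operators; the quotient by it is the Calkin algebra, which is used here
for its ring structure only. -/
def compactIdeal : Ideal (H →L[ℂ] H) where
  carrier := {A | IsCompactOperator A}
  add_mem' ha hb := ha.add hb
  zero_mem' := isCompactOperator_zero
  smul_mem' c _ hx := hx.clm_comp c

instance : (compactIdeal H).IsTwoSided := ⟨fun {a} b (ha : IsCompactOperator a) => ha.comp_clm b⟩

/-- The quotient map to the Calkin algebra. -/
abbrev calkin : (H →L[ℂ] H) →+* (H →L[ℂ] H) ⧸ compactIdeal H := Ideal.Quotient.mk _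

theorem calkin_eq_zero_iff {A : H →L[ℂ] H} : calkin A = 0 ↔ IsCompactOperator A :=
  Ideal.Quotient.eq_zero_iff_mem

theorem calkin_eq_zero_of_adjoint_mul_self [CompleteSpace H] {A : H →L[ℂ] H}
    (h : calkin (adjoint A) * calkin A = 0) : calkin A = 0 := by
  rw [← map_mul, calkin_eq_zero_iff] at h
  exact calkin_eq_zero_iff.2 (isCompactOperator_of_adjoint_comp_self h)

theorem calkin_eq_zero_of_isSelfAdjoint_of_pow [CompleteSpace H] {A : H →L[ℂ] H}
    (hA : IsSelfAdjoint A) (k : ℕ) (h : calkin A ^ 2 ^ k = 0) : calkin A = 0 := by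
  induction k with
  | zero => simpa using h
  | succ k ih =>
    refine ih ?_
    rw [← map_pow]
    apply calkin_eq_zero_of_adjoint_mul_self
    rw [← star_eq_adjoint, (hA.pow _).star_eq, map_pow, ← pow_add, ← two_mul, ← pow_succ']
    exact h

/-- In the Calkin algebra, as in any C⋆-algebra, a normal nilpotent element vanishes. -/
theorem calkin_eq_zero_of_normal_of_nilpotent [CompleteSpace H] {Q : H →L[ℂ] H}
    (hQ : calkin (adjoint Q) * calkin Q = calkin Q * calkin (adjoint Q)) {m : ℕ}
    (hm : calkin Q ^ m = 0) : calkin Q = 0 := by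
  apply calkin_eq_zero_of_adjoint_mul_self
  rw [← map_mul]
  refine calkin_eq_zero_of_isSelfAdjoint_of_pow (IsSelfAdjoint.star_mul_self Q) m ?_
  rw [map_mul, (show Commute (calkin (adjoint Q)) (calkin Q) from hQ).mul_pow,
    pow_eq_zero_of_le Nat.lt_two_pow_self.le hm, mul_zero]

/-- Two commuting unitary elements of the Calkin algebra have a normal difference, hence agree
when their difference is nilpotent. -/
theorem calkin_eq_of_unitary_of_nilpotent [CompleteSpace H] {U V : H →L[ℂ] H} (hUV : Commute U V)
    (hU : calkin (adjoint U) * calkin U = 1) (hU' : calkin U * calkin (adjoint U) = 1)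
    (hV : calkin (adjoint V) * calkin V = 1) (hV' : calkin V * calkin (adjoint V) = 1) {m : ℕ}
    (hm : (calkin U - calkin V) ^ m = 0) : calkin U = calkin V := by
  rw [← sub_eq_zero, ← map_sub]
  have hc : calkin U * calkin V = calkin V * calkin U := by rw [← map_mul, hUV.eq, map_mul]
  refine calkin_eq_zero_of_normal_of_nilpotent (m := m) ?_ (by rw [map_sub]; exact hm)
  simp only [map_sub]
  generalize calkin U = a, calkin V = b, calkin (adjoint U) = a', calkin (adjoint V) = b' at *
  have h1 : a' * b = b * a' := by
    calc a' * b = a' * (b * a) * a' := by rw [mul_assoc, mul_assoc, hU', mul_one]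
      _ = b * a' := by rw [← hc, ← mul_assoc, hU, one_mul]
  have h2 : b' * a = a * b' := by
    calc b' * a = b' * (a * b) * b' := by rw [mul_assoc, mul_assoc, hV', mul_one]
      _ = a * b' := by rw [hc, ← mul_assoc, hV, one_mul]
  simp only [mul_sub, sub_mul, hU, hU', hV, hV', h1, h2]
  abel

end CompactOperators

/-! ### The boundary estimate for doubly commuting isometries -/

section BoundaryEstimate

open ContinuousLinearMap

variable {H : Type*} [NormedAddCommGroup H] [InnerProductSpace ℂ H]

theorem norm_le_one_of_star_mul_self [CompleteSpace H] {A : H →L[ℂ] H}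
    (hA : star A * A = 1) : ‖A‖ ≤ 1 := by
  refine opNorm_le_bound _ zero_le_one fun x => ?_
  have h := apply_norm_sq_eq_inner_adjoint_left A x
  have h1 : (adjoint A ∘L A) x = x := by
    change (star A * A) x = x
    rw [hA, one_apply_eq_self]
  rw [h1, inner_self_eq_norm_sq] at h
  rw [one_mul, (sq_eq_sq₀ (norm_nonneg _) (norm_nonneg _)).1 h]

theorem norm_apply_le_of_norm_le_one {A : H →L[ℂ] H} (hA : ‖A‖ ≤ 1) (x : H) : ‖A x‖ ≤ ‖x‖ := by
  simpa using A.le_of_opNorm_le hA x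

theorem norm_pow_apply_le_of_norm_le_one {A : H →L[ℂ] H} (hA : ‖A‖ ≤ 1) (n : ℕ) (x : H) :
    ‖(A ^ n) x‖ ≤ ‖x‖ := by
  induction n with
  | zero => simp
  | succ n ih =>
    rw [pow_succ', mul_apply_eq_comp]
    exact (norm_apply_le_of_norm_le_one hA _).trans ih

variable [CompleteSpace H]

/-- The Pythagorean theorem for the range projection `A A†` of an isometry `A`. -/
theorem norm_sq_apply_one_sub_mul_star {A : H →L[ℂ] H} (hA : star A * A = 1) (x : H) :
    ‖(1 - A * star A) x‖ ^ 2 = ‖x‖ ^ 2 - ‖star A x‖ ^ 2 := by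
  have h1 : star (1 - A * star A) * (1 - A * star A) = 1 - A * star A := by
    have h2 : A * star A * (A * star A) = A * star A := by
      rw [mul_assoc, ← mul_assoc (star A), hA, one_mul]
    simp only [star_sub, star_one, star_mul, star_star, mul_sub, sub_mul, one_mul, mul_one, h2]
    abel
  rw [apply_norm_sq_eq_inner_adjoint_left, ← star_eq_adjoint, ← mul_def, h1,
    apply_norm_sq_eq_inner_adjoint_left (star A), ← star_eq_adjoint (star A), star_star, ← mul_def,
    ← inner_self_eq_norm_sq (𝕜 := ℂ) x, sub_apply, one_apply_eq_self, inner_sub_left, map_sub]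

/-- The mean of the first `M` powers of `c • B A†`. -/
noncomputable def shiftMean (A B : H →L[ℂ] H) (c : ℂ) (M : ℕ) : H →L[ℂ] H :=
  (M : ℂ)⁻¹ • ∑ t ∈ Finset.range M, c ^ t • (B ^ t * star A ^ t)

variable {A B : H →L[ℂ] H} {c : ℂ}

theorem norm_shiftMean_le (hA : ‖A‖ ≤ 1) (hB : ‖B‖ ≤ 1) (hc : ‖c‖ ≤ 1) (M : ℕ) :
    ‖shiftMean A B c M‖ ≤ 1 := by
  have h : ‖∑ t ∈ Finset.range M, c ^ t • (B ^ t * star A ^ t)‖ ≤ M := by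
    refine (norm_sum_le _ _).trans ((Finset.sum_le_card_nsmul _ _ 1 fun t _ => ?_).trans (by simp))
    refine opNorm_le_bound _ zero_le_one fun x => ?_
    rw [smul_apply, norm_smul, norm_pow, mul_apply_eq_comp]
    have h1 := norm_pow_apply_le_of_norm_le_one hB t ((star A ^ t) x)
    have h2 := norm_pow_apply_le_of_norm_le_one (A := star A) (by rwa [norm_star]) t x
    have h3 := pow_le_one₀ (n := t) (norm_nonneg c) hc
    exact mul_le_mul h3 (h1.trans h2) (norm_nonneg _) zero_le_one
  rw [shiftMean, norm_smul, norm_inv, Complex.norm_natCast]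
  exact inv_mul_le_one_of_le₀ h (Nat.cast_nonneg M)

/-- The vectors `(1 - A A†) A†^t g` are, up to the isometries `A ^ t`, the components of `g` in the
orthogonal Wold decomposition of `A`, so that the mean of `M` of them is
smaller than `g` by a factor `√M`. -/
theorem norm_one_sub_mul_star_shiftMean_le (hA : star A * A = 1) (hB : star B * B = 1)
    (hAB : Commute A B) (hAB' : Commute (star A) B) (hc : ‖c‖ ≤ 1) (M : ℕ) (g : H) :
    ‖(1 - A * star A) (shiftMean A B c M g)‖ ≤ (√M)⁻¹ * ‖g‖ := by
  rcases Nat.eq_zero_or_pos M with rfl | hM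
  · simp [shiftMean]
  have hB1 := norm_le_one_of_star_mul_self hB
  set E := 1 - A * star A with hE
  have hEB : Commute E B := (Commute.one_left B).sub_left (hAB.mul_left hAB')
  have h1 : E (shiftMean A B c M g) =
      (M : ℂ)⁻¹ • ∑ t ∈ Finset.range M, c ^ t • (B ^ t) (E ((star A ^ t) g)) := by
    simp only [shiftMean, smul_apply, sum_apply, map_smul, map_sum, mul_apply_eq_comp]
    congr 1
    refine Finset.sum_congr rfl fun t _ => ?_
    rw [← mul_apply_eq_comp, (hEB.pow_right t).eq, mul_apply_eq_comp]
  have h2 : ‖∑ t ∈ Finset.range M, c ^ t • (B ^ t) (E ((star A ^ t) g))‖ ≤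
      ∑ t ∈ Finset.range M, ‖E ((star A ^ t) g)‖ := by
    refine (norm_sum_le _ _).trans (Finset.sum_le_sum fun t _ => ?_)
    rw [norm_smul, norm_pow]
    have h3 := pow_le_one₀ (n := t) (norm_nonneg c) hc
    have h4 := norm_pow_apply_le_of_norm_le_one hB1 t (E ((star A ^ t) g))
    simpa using mul_le_mul h3 h4 (norm_nonneg _) zero_le_one
  have h3 : ∑ t ∈ Finset.range M, ‖E ((star A ^ t) g)‖ ^ 2 ≤ ‖g‖ ^ 2 := by
    have h4 : ∀ t, ‖E ((star A ^ t) g)‖ ^ 2 =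
        ‖(star A ^ t) g‖ ^ 2 - ‖(star A ^ (t + 1)) g‖ ^ 2 := fun t => by
      rw [hE, norm_sq_apply_one_sub_mul_star hA, pow_succ' (star A), mul_apply_eq_comp]
    rw [Finset.sum_congr rfl fun t _ => h4 t,
      Finset.sum_range_sub' (fun t => ‖(star A ^ t) g‖ ^ 2)]
    simp only [pow_zero, one_apply_eq_self]
    linarith [sq_nonneg ‖(star A ^ M) g‖]
  have h4 : (∑ t ∈ Finset.range M, ‖E ((star A ^ t) g)‖) ^ 2 ≤ (√M * ‖g‖) ^ 2 := by
    refine sq_sum_le_card_mul_sum_sq.trans ?_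
    rw [Finset.card_range, mul_pow, Real.sq_sqrt (Nat.cast_nonneg M)]
    gcongr
  have h5 := (pow_le_pow_iff_left₀ (Finset.sum_nonneg fun _ _ => norm_nonneg _)
    (by positivity) two_ne_zero).1 h4
  rw [h1, norm_smul, norm_inv, Complex.norm_natCast]
  have hM' : (0 : ℝ) < M := by exact_mod_cast hM
  calc (M : ℝ)⁻¹ * _ ≤ (M : ℝ)⁻¹ * (√M * ‖g‖) := by
        gcongr
        exact h2.trans h5
    _ = (√M)⁻¹ * ‖g‖ := by
        rw [← mul_assoc]
        congr 1
        have h6 : √(M : ℝ) ≠ 0 := (Real.sqrt_pos.2 hM').ne'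
        nth_rewrite 1 [← Real.mul_self_sqrt hM'.le]
        field_simp

theorem star_pow_mul_pow (hB : star B * B = 1) (t : ℕ) : star B ^ t * B ^ t = 1 := by
  induction t with
  | zero => simp
  | succ t ih => rw [pow_succ, pow_succ', mul_assoc, ← mul_assoc (star B), hB, one_mul, ih]

/-- On the range of a high power of `B`, the operator `1 - shiftMean A B c M` is divisible by
`B† - c A†`. -/
theorem exists_star_pow_mul_one_sub_shiftMean (hB : star B * B = 1) (hAB : Commute A B) {M : ℕ}
    (hM : M ≠ 0) :
    ∃ G : H →L[ℂ] H, Commute G (star A) ∧ Commute G (star B) ∧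
      star B ^ M * (1 - shiftMean A B c M) = G * (star B - c • star A) := by
  have hab : Commute (star A) (star B) := hAB.star_star
  have hab' : Commute (star B) (c • star A) := hab.symm.smul_right c
  refine ⟨(M : ℂ)⁻¹ • ∑ t ∈ Finset.range M, star B ^ (M - t) *
    ∑ i ∈ Finset.range t, star B ^ i * (c • star A) ^ (t - 1 - i), ?_, ?_, ?_⟩
  · refine Commute.smul_left (Commute.sum_left _ _ _ fun t _ => ?_) _
    refine (hab.symm.pow_left _).mul_left (Commute.sum_left _ _ _ fun i _ => ?_)
    exact (hab.symm.pow_left _).mul_left (((Commute.refl _).smul_left c).pow_left _)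
  · refine Commute.smul_left (Commute.sum_left _ _ _ fun t _ => ?_) _
    refine ((Commute.refl _).pow_left _).mul_left (Commute.sum_left _ _ _ fun i _ => ?_)
    exact ((Commute.refl _).pow_left _).mul_left (hab'.symm.pow_left _)
  · have hM' : (M : ℂ) ≠ 0 := by exact_mod_cast hM
    have h1 : ∀ t ∈ Finset.range M, star B ^ M * (c ^ t • (B ^ t * star A ^ t)) =
        star B ^ (M - t) * (c • star A) ^ t := by
      intro t ht
      have h2 : star B ^ M = star B ^ (M - t) * star B ^ t := by
        rw [← pow_add, Nat.sub_add_cancel (Finset.mem_range.1 ht).le]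
      rw [mul_smul_comm, h2, mul_assoc, ← mul_assoc (star B ^ t), star_pow_mul_pow hB, one_mul,
        smul_pow, mul_smul_comm]
    have h3 : ∀ t ∈ Finset.range M, star B ^ (M - t) *
        (∑ i ∈ Finset.range t, star B ^ i * (c • star A) ^ (t - 1 - i)) *
          (star B - c • star A) = star B ^ M - star B ^ (M - t) * (c • star A) ^ t := by
      intro t ht
      rw [mul_assoc, hab'.geom_sum₂_mul, mul_sub, ← pow_add,
        Nat.sub_add_cancel (Finset.mem_range.1 ht).le]
    rw [shiftMean, mul_sub, mul_one, mul_smul_comm, Finset.mul_sum, Finset.sum_congr rfl h1,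
      smul_mul_assoc, Finset.sum_mul, Finset.sum_congr rfl h3, Finset.sum_sub_distrib,
      Finset.sum_const, Finset.card_range, smul_sub, ← Nat.cast_smul_eq_nsmul ℂ, smul_smul,
      inv_mul_cancel₀ hM', one_smul]

/-- A vector which is annihilated by a power of `B† - c A†`, where `A` and `B` are doubly commuting
isometries and `|c| ≤ 1`, has a small component in the range of `(1 - A A†) B ^ n`, `n` large.
For shifts on square summable families: if `f` satisfies in the direction `(l, j)` a recurrence of
the form `(x - c) ^ m`, then a value at the end of a long segment in this direction is
a combination, with small coefficients, of the values on the segment. -/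
theorem norm_star_pow_one_sub_mul_star_le (hA : star A * A = 1) (hB : star B * B = 1)
    (hAB : Commute A B) (hAB' : Commute (star A) B) (hc : ‖c‖ ≤ 1) {m M : ℕ} (hM : M ≠ 0) {f : H}
    (hf : ((star B - c • star A) ^ m) f = 0) :
    ‖(star B ^ (m * M)) ((1 - A * star A) f)‖ ≤ 2 ^ m * (√M)⁻¹ * ‖f‖ := by
  set D := star B - c • star A with hD
  set Y := shiftMean A B c M with hY
  set E := 1 - A * star A with hE
  have hA1 := norm_le_one_of_star_mul_self hA
  have hB1 := norm_le_one_of_star_mul_self hB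
  obtain ⟨G, hGa, hGb, hG⟩ := exists_star_pow_mul_one_sub_shiftMean (c := c) hB hAB hM
  have hab : Commute (star B) (star A) := hAB.symm.star_star
  have hGD : Commute G D := hGb.sub_right (hGa.smul_right c)
  have hbD : Commute (star B) D := (Commute.refl _).sub_right (hab.smul_right c)
  have hpow : ∀ k, star B ^ (k * M) * (1 - Y) ^ k = (G * D) ^ k := by
    intro k
    induction k with
    | zero => simp
    | succ k ih =>
      have h1 : Commute (star B ^ (k * M)) (G * D) :=
        (hGb.symm.pow_left _).mul_right (hbD.pow_left _)
      rw [Nat.succ_mul, pow_add, pow_succ' (1 - Y), mul_assoc, ← mul_assoc (star B ^ M), hG,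
        ← mul_assoc, h1.eq, mul_assoc, ih, ← pow_succ']
  have hzero : (star B ^ (m * M)) (((1 - Y) ^ m) f) = 0 := by
    rw [← mul_apply_eq_comp, hpow, hGD.mul_pow, mul_apply_eq_comp, hf, map_zero]
  set Z := ∑ r ∈ Finset.range m, (1 - Y) ^ r with hZ
  have hsplit : f = Y (Z f) + ((1 - Y) ^ m) f := by
    have h1 : Y * Z + (1 - Y) ^ m = 1 := by
      have h2 := mul_geom_sum (1 - Y) m
      rw [← hZ, sub_sub_cancel_left, neg_mul] at h2
      rw [eq_add_of_sub_eq h2.symm]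
      abel
    rw [← mul_apply_eq_comp, ← add_apply, h1, one_apply_eq_self]
  have hZn : ‖Z‖ ≤ 2 ^ m := by
    have h1 : ‖(1 : H →L[ℂ] H) - Y‖ ≤ 2 := by
      refine (norm_sub_le _ _).trans ?_
      have h2 : ‖(1 : H →L[ℂ] H)‖ ≤ 1 := norm_id_le
      linarith [norm_shiftMean_le hA1 hB1 hc M]
    have h2 : ∀ r, ‖((1 : H →L[ℂ] H) - Y) ^ r‖ ≤ 2 ^ r := by
      intro r
      induction r with
      | zero =>
        rw [pow_zero, pow_zero]
        exact norm_id_le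
      | succ r ih =>
        rw [pow_succ, pow_succ]
        exact (norm_mul_le _ _).trans (mul_le_mul ih h1 (norm_nonneg _) (by positivity))
    refine (norm_sum_le _ _).trans ((Finset.sum_le_sum fun r _ => h2 r).trans ?_)
    have h3 := geom_sum_eq (x := (2 : ℝ)) (by norm_num) m
    rw [h3]
    norm_num
  have hEb : Commute E (star B) := by
    refine (Commute.one_left _).sub_left (Commute.mul_left ?_ hab.symm)
    simpa using hAB'.star_star
  have h1 : (star B ^ (m * M)) (E f) = (star B ^ (m * M)) (E (Y (Z f))) := by
    have h2 : ∀ x, (star B ^ (m * M)) (E x) = E ((star B ^ (m * M)) x) := fun x => by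
      rw [← mul_apply_eq_comp, ← (hEb.pow_right _).eq, mul_apply_eq_comp]
    rw [h2, h2]
    conv_lhs => rw [hsplit]
    rw [map_add, hzero, add_zero]
  rw [h1]
  refine (norm_pow_apply_le_of_norm_le_one (A := star B) (by rwa [norm_star]) _ _).trans ?_
  refine (norm_one_sub_mul_star_shiftMean_le hA hB hAB hAB' hc M (Z f)).trans ?_
  rw [mul_comm (2 ^ m), mul_assoc]
  gcongr
  exact Z.le_of_opNorm_le hZn f

end BoundaryEstimate

/-! ### Monomials and shifts in the Hardy space -/

section Shifts

open ContinuousLinearMap MvPolynomial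

variable {d : ℕ}

/-- The Hilbert basis of the Hardy space for which the coordinates are the Taylor coefficients;
by `monomialBasis_apply` its elements are the monomials. -/
noncomputable def monomialBasis (d : ℕ) : HilbertBasis (Fin d → ℕ) ℂ (HardySpace d) :=
  HilbertBasis.ofRepr (taylorEquiv d)

theorem coeff_ofPoly_monomial (α β : Fin d →₀ ℕ) :
    PolydiscHardy.coeff (ofPoly d (monomial α 1)).toFun β = if β = α then 1 else 0 := by
  classical
  have h1 : (ofPoly d (monomial α 1)).toFun =
      powerSum (fun γ : Fin d → ℕ => if γ = α then 1 else 0) := by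
    change (polydisc d).indicator _ = (polydisc d).indicator _
    congr 1
    funext z
    rw [tsum_eq_single (α : Fin d → ℕ) fun γ hγ => by simp [hγ]]
    simp [eval_monomial, Finsupp.prod_fintype]
  rw [h1, coeff_powerSum (C := 1) fun γ => by split_ifs <;> simp]
  simp [DFunLike.coe_fn_eq]

theorem monomialBasis_apply (α : Fin d →₀ ℕ) :
    monomialBasis d α = ofPoly d (monomial α 1) := by
  classical
  apply (taylorEquiv d).injective
  have h1 := (monomialBasis d).repr_self α
  refine (show taylorEquiv d (monomialBasis d α) = lp.single 2 (α : Fin d → ℕ) (1 : ℂ) from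
    h1).trans ?_
  ext β
  have h2 := coeff_ofPoly_monomial α (Finsupp.equivFunOnFinite.symm β)
  rw [Finsupp.coe_equivFunOnFinite_symm] at h2
  refine Eq.trans ?_ h2.symm
  rw [lp.single_apply, Pi.single_apply]
  congr 1
  rw [eq_iff_iff]
  constructor
  · rintro rfl; simp
  · rintro rfl; simp

theorem monomialBasis_eq_ofPoly (α : Fin d → ℕ) :
    monomialBasis d α = ofPoly d (monomial (Finsupp.equivFunOnFinite.symm α) 1) := by
  rw [← monomialBasis_apply, Finsupp.coe_equivFunOnFinite_symm]

theorem mulPoly_toFun (q : MvPolynomial (Fin d) ℂ) (f : HardySpace d) :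
    (mulPoly q f).toFun = fun z => eval z q * f.toFun z := rfl

theorem ofPoly_toFun (q : MvPolynomial (Fin d) ℂ) {z : Fin d → ℂ} (hz : z ∈ polydisc d) :
    (ofPoly d q).toFun z = eval z q :=
  indicator_of_mem (f := fun z => eval z q) hz

theorem mulPoly_ofPoly (p q : MvPolynomial (Fin d) ℂ) :
    mulPoly p (ofPoly d q) = ofPoly d (p * q) :=
  HardySpace.ext_on fun z hz => by
    rw [mulPoly_toFun]
    simp only [ofPoly_toFun _ hz, map_mul]

/-- Multiplication by polynomials, as an algebra homomorphism. -/
noncomputable def mulPolyHom (d : ℕ) :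
    MvPolynomial (Fin d) ℂ →ₐ[ℂ] (HardySpace d →L[ℂ] HardySpace d) :=
  AlgHom.ofLinearMap
    { toFun := mulPoly
      map_add' := fun p q => by
        ext f
        exact HardySpace.ext_on fun z _ => by
          simp [HardySpace.toFun_add, mulPoly_toFun, add_mul]
      map_smul' := fun c q => by
        ext f
        exact HardySpace.ext_on fun z _ => by
          simp [HardySpace.toFun_smul, mulPoly_toFun, mul_assoc] }
    (by
      ext f
      exact HardySpace.ext_on fun z _ => by simp [mulPoly_toFun])
    (fun p q => by
      ext f
      exact HardySpace.ext_on fun z _ => by simp [mulPoly_toFun, mul_assoc])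

theorem mulPolyHom_apply (q : MvPolynomial (Fin d) ℂ) : mulPolyHom d q = mulPoly q := rfl

theorem mulPoly_mul (p q : MvPolynomial (Fin d) ℂ) :
    mulPoly (p * q) = mulPoly p * mulPoly q := map_mul (mulPolyHom d) p q

/-- Multiplication by a coordinate function. -/
noncomputable abbrev shift (j : Fin d) : HardySpace d →L[ℂ] HardySpace d := mulPoly (X j)

theorem shift_monomialBasis (j : Fin d) (α : Fin d → ℕ) :
    shift j (monomialBasis d α) = monomialBasis d (α + Pi.single j 1) := by
  rw [monomialBasis_eq_ofPoly, monomialBasis_eq_ofPoly, mulPoly_ofPoly, X, monomial_mul, one_mul]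
  congr 3
  ext i
  simp [Finsupp.single_apply, Pi.single_apply, add_comm, eq_comm]

theorem commute_shift (j l : Fin d) : Commute (shift j) (shift l) := by
  rw [Commute, SemiconjBy, ← mulPoly_mul, ← mulPoly_mul, mul_comm]

theorem clm_ext_monomialBasis {G : Type*} [NormedAddCommGroup G] [NormedSpace ℂ G]
    {A B : HardySpace d →L[ℂ] G} (h : ∀ α, A (monomialBasis d α) = B (monomialBasis d α)) :
    A = B := by
  refine ContinuousLinearMap.ext_on (s := range (monomialBasis d))
    (Submodule.dense_iff_topologicalClosure_eq_top.2 (monomialBasis d).dense_span) ?_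
  rintro _ ⟨α, rfl⟩
  exact h α

theorem ext_inner_monomialBasis {f g : HardySpace d}
    (h : ∀ α, inner ℂ (monomialBasis d α) f = inner ℂ (monomialBasis d α) g) : f = g := by
  apply (monomialBasis d).repr.injective
  ext α
  simpa only [HilbertBasis.repr_apply_apply] using h α

theorem inner_monomialBasis (α β : Fin d → ℕ) :
    inner ℂ (monomialBasis d α) (monomialBasis d β) = if α = β then (1 : ℂ) else 0 := by
  classical
  rw [orthonormal_iff_ite.1 (monomialBasis d).orthonormal]

theorem inner_monomialBasis_star_shift (j : Fin d) (α : Fin d → ℕ) (f : HardySpace d) :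
    inner ℂ (monomialBasis d α) (star (shift j) f) =
      inner ℂ (monomialBasis d (α + Pi.single j 1)) f := by
  rw [star_eq_adjoint, adjoint_inner_right, shift_monomialBasis]

theorem star_shift_mul_shift (j : Fin d) : star (shift j) * shift j = 1 := by
  refine clm_ext_monomialBasis fun α => ext_inner_monomialBasis fun β => ?_
  rw [mul_apply_eq_comp, inner_monomialBasis_star_shift, shift_monomialBasis, one_apply_eq_self,
    inner_monomialBasis, inner_monomialBasis]
  simp

theorem star_shift_monomialBasis_of_eq_zero {j : Fin d} {α : Fin d → ℕ} (h : α j = 0) :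
    star (shift j) (monomialBasis d α) = 0 := by
  refine ext_inner_monomialBasis fun β => ?_
  rw [inner_monomialBasis_star_shift, inner_monomialBasis, inner_zero_right, if_neg]
  rintro rfl
  simp at h

theorem star_shift_apply_shift (j : Fin d) (f : HardySpace d) :
    star (shift j) (shift j f) = f := by
  rw [← mul_apply_eq_comp, star_shift_mul_shift, one_apply_eq_self]

theorem sub_single_add_single {j : Fin d} {α : Fin d → ℕ} (h : α j ≠ 0) :
    α - Pi.single j 1 + Pi.single j 1 = α := by
  refine tsub_add_cancel_of_le fun i => ?_
  by_cases hi : i = j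
  · subst hi
    simpa [Nat.one_le_iff_ne_zero] using h
  · simp [hi]

theorem commute_star_shift {j l : Fin d} (h : l ≠ j) : Commute (star (shift j)) (shift l) := by
  refine clm_ext_monomialBasis fun α => ?_
  rw [mul_apply_eq_comp, mul_apply_eq_comp]
  by_cases hα : α j = 0
  · rw [star_shift_monomialBasis_of_eq_zero hα, shift_monomialBasis,
      star_shift_monomialBasis_of_eq_zero (by simp [hα, h.symm]), map_zero]
  · rw [← sub_single_add_single hα, ← shift_monomialBasis, star_shift_apply_shift,
      ← mul_apply_eq_comp (shift l), ← (commute_shift j l).eq, mul_apply_eq_comp,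
      star_shift_apply_shift]

end Shifts

/-! ### Truncations and compactness at the boundary -/

section Truncation

open ContinuousLinearMap MvPolynomial

variable {d : ℕ}

theorem hasSum_inner_monomialBasis (f : HardySpace d) :
    HasSum (fun α => ‖(inner ℂ (monomialBasis d α) f : ℂ)‖ ^ 2) (‖f‖ ^ 2) := by
  refine f.hasSum_coeff.congr_fun fun α => ?_
  rw [← HilbertBasis.repr_apply_apply]
  rfl

/-- The orthogonal projection onto the span of finitely many monomials. -/
noncomputable def truncation (s : Finset (Fin d → ℕ)) : HardySpace d →L[ℂ] HardySpace d :=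
  ∑ α ∈ s, (innerSL ℂ (monomialBasis d α)).smulRight (monomialBasis d α)

theorem isCompactOperator_truncation (s : Finset (Fin d → ℕ)) :
    IsCompactOperator (truncation s) := by
  classical
  unfold truncation
  induction s using Finset.induction_on with
  | empty => exact isCompactOperator_zero
  | insert α s hα ih =>
    rw [Finset.sum_insert hα]
    refine IsCompactOperator.add ?_ ih
    exact (isCompactOperator_of_locallyCompactSpace_dom
      (innerSL ℂ (monomialBasis d α))).clm_comp (toSpanSingleton ℂ (monomialBasis d α))

theorem inner_truncation [DecidableEq (Fin d → ℕ)] (s : Finset (Fin d → ℕ)) (α : Fin d → ℕ)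
    (f : HardySpace d) :
    inner ℂ (monomialBasis d α) (truncation s f) =
      if α ∈ s then inner ℂ (monomialBasis d α) f else (0 : ℂ) := by
  simp only [truncation, sum_apply, smulRight_apply, innerSL_apply_apply, inner_sum,
    inner_smul_right, inner_monomialBasis, mul_ite, mul_one, mul_zero, Finset.sum_ite_eq]

theorem shift_pow_monomialBasis (l : Fin d) (K : ℕ) (α : Fin d → ℕ) :
    (shift l ^ K) (monomialBasis d α) = monomialBasis d (α + Pi.single l K) := by
  induction K with
  | zero => simp
  | succ K ih =>
    rw [pow_succ', mul_apply_eq_comp, ih, shift_monomialBasis, add_assoc, ← Pi.single_add]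

theorem inner_shift_pow_mul_star_pow (l : Fin d) (K : ℕ) (α : Fin d → ℕ) (f : HardySpace d) :
    inner ℂ (monomialBasis d α) ((shift l ^ K) ((star (shift l) ^ K) f)) =
      if K ≤ α l then inner ℂ (monomialBasis d α) f else (0 : ℂ) := by
  have hadj : ∀ x y : HardySpace d, inner ℂ x ((star (shift l) ^ K) y) =
      (inner ℂ ((shift l ^ K) x) y : ℂ) := fun x y => by
    rw [← star_pow, star_eq_adjoint, adjoint_inner_right]
  have hadj' : ∀ x y : HardySpace d, inner ℂ x ((shift l ^ K) y) =
      (inner ℂ ((star (shift l) ^ K) x) y : ℂ) := fun x y => by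
    rw [← star_pow, star_eq_adjoint, adjoint_inner_left]
  rw [hadj']
  split_ifs with h
  · have h1 : α = α - Pi.single l K + Pi.single l K := by
      refine (tsub_add_cancel_of_le fun i => ?_).symm
      by_cases hi : i = l
      · subst hi
        simpa using h
      · simp [hi]
    have h2 : (star (shift l) ^ K) (monomialBasis d α) = monomialBasis d (α - Pi.single l K) := by
      conv_lhs => rw [h1, ← shift_pow_monomialBasis, ← mul_apply_eq_comp,
        star_pow_mul_pow (star_shift_mul_shift l), one_apply_eq_self]
    rw [h2, hadj, shift_pow_monomialBasis, ← h1]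
  · have h2 : (star (shift l) ^ K) (monomialBasis d α) = 0 := by
      refine ext_inner_monomialBasis fun β => ?_
      rw [hadj, shift_pow_monomialBasis, inner_monomialBasis, inner_zero_right, if_neg]
      rintro rfl
      simp at h
    rw [h2, inner_zero_left]

theorem norm_shift_pow_apply (l : Fin d) (K : ℕ) (f : HardySpace d) :
    ‖(shift l ^ K) f‖ = ‖f‖ := by
  refine le_antisymm (norm_pow_apply_le_of_norm_le_one
    (norm_le_one_of_star_mul_self (star_shift_mul_shift l)) K f) ?_
  have h := norm_pow_apply_le_of_norm_le_one (A := star (shift l))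
    (by rw [norm_star]; exact norm_le_one_of_star_mul_self (star_shift_mul_shift l)) K
    ((shift l ^ K) f)
  rwa [← mul_apply_eq_comp, star_pow_mul_pow (star_shift_mul_shift l), one_apply_eq_self] at h

/-- A function which does not depend on `z j` is close to a polynomial as soon as its coefficients
of large index in each other coordinate direction are small. -/
theorem norm_sq_sub_truncation_le {j : Fin d} {K : ℕ} (hK : K ≠ 0) {g : HardySpace d}
    (hg : ∀ α : Fin d → ℕ, α j ≠ 0 → (inner ℂ (monomialBasis d α) g : ℂ) = 0) :
    ‖g - truncation (Fintype.piFinset fun _ => Finset.range K) g‖ ^ 2 ≤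
      ∑ l ∈ Finset.univ.erase j, ‖(star (shift l) ^ K) g‖ ^ 2 := by
  classical
  have h1 : HasSum (fun α => ∑ l ∈ Finset.univ.erase j,
      ‖(inner ℂ (monomialBasis d α) ((shift l ^ K) ((star (shift l) ^ K) g)) : ℂ)‖ ^ 2)
      (∑ l ∈ Finset.univ.erase j, ‖(star (shift l) ^ K) g‖ ^ 2) := by
    refine hasSum_sum fun l _ => ?_
    rw [← norm_shift_pow_apply l K]
    exact hasSum_inner_monomialBasis _
  refine hasSum_le (fun α => ?_) (hasSum_inner_monomialBasis _) h1
  have hnn : ∀ l ∈ Finset.univ.erase j, 0 ≤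
      ‖(inner ℂ (monomialBasis d α) ((shift l ^ K) ((star (shift l) ^ K) g)) : ℂ)‖ ^ 2 :=
    fun _ _ => by positivity
  rw [inner_sub_right, inner_truncation]
  by_cases hα : α ∈ Fintype.piFinset fun _ => Finset.range K
  · rw [if_pos hα, sub_self, norm_zero, zero_pow two_ne_zero]
    exact Finset.sum_nonneg hnn
  · rw [if_neg hα, sub_zero]
    by_cases hj : α j = 0
    · simp only [Fintype.mem_piFinset, Finset.mem_range, not_forall, not_lt] at hα
      obtain ⟨l, hl⟩ := hα
      have hlj : l ≠ j := by
        rintro rfl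
        omega
      refine le_trans (le_of_eq ?_) (Finset.single_le_sum hnn
        (Finset.mem_erase.2 ⟨hlj, Finset.mem_univ l⟩))
      rw [inner_shift_pow_mul_star_pow, if_pos hl]
    · rw [hg α hj, norm_zero, zero_pow two_ne_zero]
      exact Finset.sum_nonneg hnn

theorem inner_one_sub_shift_mul_star (j : Fin d) (f : HardySpace d) {α : Fin d → ℕ}
    (hα : α j ≠ 0) : (inner ℂ (monomialBasis d α) ((1 - shift j * star (shift j)) f) : ℂ) = 0 := by
  have h := inner_shift_pow_mul_star_pow j 1 α f
  rw [pow_one, pow_one, if_pos (Nat.one_le_iff_ne_zero.2 hα)] at h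
  rw [sub_apply, one_apply_eq_self, mul_apply_eq_comp, inner_sub_right, h, sub_self]

theorem exists_star_pow_one_sub_le {N : Submodule ℂ (HardySpace d)} {j l : Fin d} (hlj : l ≠ j)
    {c : ℂ} (hc : ‖c‖ ≤ 1) {m : ℕ}
    (hN : ∀ f ∈ N, ((star (shift l) - c • star (shift j)) ^ m) f = 0) {δ : ℝ} (hδ : 0 < δ) :
    ∃ K₀, ∀ K ≥ K₀, ∀ f ∈ N,
      ‖(star (shift l) ^ K) ((1 - shift j * star (shift j)) f)‖ ≤ δ * ‖f‖ := by
  have h1 : Filter.Tendsto (fun M : ℕ => 2 ^ m * (√(M : ℝ))⁻¹) Filter.atTop (𝓝 0) := by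
    have := (tendsto_inv_atTop_zero.comp
      (Real.tendsto_sqrt_atTop.comp tendsto_natCast_atTop_atTop)).const_mul ((2 : ℝ) ^ m)
    simpa using this
  obtain ⟨M, hM, hM0⟩ := ((h1.eventually (gt_mem_nhds hδ)).and
    (Filter.eventually_ne_atTop 0)).exists
  refine ⟨m * M, fun K hK f hf => ?_⟩
  have h2 := norm_star_pow_one_sub_mul_star_le (star_shift_mul_shift j) (star_shift_mul_shift l)
    (commute_shift j l) (commute_star_shift hlj) hc hM0 (hN f hf)
  obtain ⟨k, rfl⟩ := Nat.exists_eq_add_of_le' hK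
  rw [pow_add, mul_apply_eq_comp]
  refine (norm_pow_apply_le_of_norm_le_one (A := star (shift l)) ?_ _ _).trans (h2.trans ?_)
  · rw [norm_star]
    exact norm_le_one_of_star_mul_self (star_shift_mul_shift l)
  · gcongr

/-- If for each `l ≠ j` the functions in `N` satisfy a recurrence in the direction `(l, j)` with
a characteristic root in the closed disc, then the projection onto the functions which do not depend
on `z j` is compact on `N`. -/
theorem isCompactOperator_one_sub_shift_mul_star {N : Submodule ℂ (HardySpace d)}
    [CompleteSpace N] {j : Fin d}
    (hN : ∀ l ≠ j, ∃ c : ℂ, ‖c‖ ≤ 1 ∧ ∃ m : ℕ,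
      ∀ f ∈ N, ((star (shift l) - c • star (shift j)) ^ m) f = 0) :
    IsCompactOperator ((1 - shift j * star (shift j)) ∘L N.subtypeL) := by
  refine isCompactOperator_of_approx fun ε hε => ?_
  -- At most `d` directions contribute, and `d * (ε / (d + 1)) ^ 2 ≤ ε ^ 2`.
  have hδ : 0 < ε / (d + 1) := by positivity
  have h1 : ∀ l, ∃ K₀, l ≠ j → ∀ K ≥ K₀, ∀ f ∈ N,
      ‖(star (shift l) ^ K) ((1 - shift j * star (shift j)) f)‖ ≤ ε / (d + 1) * ‖f‖ := by
    intro l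
    by_cases hlj : l = j
    · exact ⟨0, fun h => absurd hlj h⟩
    · obtain ⟨c, hc, m, hm⟩ := hN l hlj
      obtain ⟨K₀, hK₀⟩ := exists_star_pow_one_sub_le hlj hc hm hδ
      exact ⟨K₀, fun _ => hK₀⟩
  choose K₀ hK₀ using h1
  -- The truncation estimate needs `K ≠ 0`, which keeps the indices with `α j = 0` in the box.
  set K := ∑ l, K₀ l + 1 with hK
  have hKl : ∀ l, K₀ l ≤ K := fun l =>
    (Finset.single_le_sum (f := K₀) (fun _ _ => Nat.zero_le _) (Finset.mem_univ l)).trans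
      (Nat.le_succ _)
  refine ⟨truncation (Fintype.piFinset fun _ => Finset.range K) ∘L
    ((1 - shift j * star (shift j)) ∘L N.subtypeL), (isCompactOperator_truncation _).comp_clm _, ?_⟩
  refine opNorm_le_bound _ hε.le fun f => ?_
  set g := (1 - shift j * star (shift j)) (f : HardySpace d) with hg
  have h2 := norm_sq_sub_truncation_le (j := j) (K := K) (Nat.succ_ne_zero _) (g := g)
    fun α hα => inner_one_sub_shift_mul_star j f hα
  have h3 : ∑ l ∈ Finset.univ.erase j, ‖(star (shift l) ^ K) g‖ ^ 2 ≤ (ε * ‖f‖) ^ 2 := by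
    have h4 : ∀ l ∈ Finset.univ.erase j, ‖(star (shift l) ^ K) g‖ ^ 2 ≤
        (ε / (d + 1) * ‖f‖) ^ 2 := by
      intro l hl
      have := hK₀ l (Finset.ne_of_mem_erase hl) K (hKl l) f f.2
      gcongr
      exact this
    refine (Finset.sum_le_card_nsmul _ _ _ h4).trans ?_
    have h5 : ((Finset.univ.erase j).card : ℝ) ≤ d := by
      exact_mod_cast (Finset.card_le_univ _).trans (by simp)
    rw [nsmul_eq_mul]
    have h6 : (d : ℝ) * (ε / (d + 1) * ‖f‖) ^ 2 ≤ (ε * ‖f‖) ^ 2 := by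
      have h7 : (ε / (d + 1) * ‖f‖) ^ 2 = (ε * ‖f‖) ^ 2 / ((d : ℝ) + 1) ^ 2 := by
        field_simp
      rw [h7, mul_div_assoc', div_le_iff₀ (by positivity), mul_comm]
      gcongr
      nlinarith [(Nat.cast_nonneg d : (0 : ℝ) ≤ d)]
    exact le_trans (by gcongr) h6
  exact (pow_le_pow_iff_left₀ (norm_nonneg _) (by positivity) two_ne_zero).1 (h2.trans h3)

end Truncation

/-! ### Essentially coisometric weighted shifts of degree one -/

section Grading

open ContinuousLinearMap

variable {H : Type*} [NormedAddCommGroup H] [InnerProductSpace ℂ H]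

/-- The subspace of vectors of degree `n`. -/
def gradedPart (q : ℕ → H →L[ℂ] H) (n : ℕ) : Submodule ℂ H :=
  LinearMap.eqLocus (q n : H →ₗ[ℂ] H) LinearMap.id

variable {q : ℕ → H →L[ℂ] H} {A : H →L[ℂ] H}

theorem mem_gradedPart {n : ℕ} {x : H} : x ∈ gradedPart q n ↔ q n x = x := Iff.rfl

variable [CompleteSpace H]

/-- The operators `q n` are the orthogonal projections onto the summands of a decomposition of `H`
in finite-dimensional subspaces, indexed by the degree `n`. -/
structure IsGrading (q : ℕ → H →L[ℂ] H) : Prop where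
  star_eq : ∀ n, star (q n) = q n
  mul_self : ∀ n, q n * q n = q n
  mul_of_ne : ∀ m n, m ≠ n → q m * q n = 0
  compact : ∀ n, IsCompactOperator (q n)
  hasSum : ∀ x, HasSum (fun n => ‖q n x‖ ^ 2) (‖x‖ ^ 2)

theorem norm_sq_star_apply (A : H →L[ℂ] H) (x : H) :
    ‖star A x‖ ^ 2 = ‖x‖ ^ 2 - (inner ℂ ((1 - A * star A) x) x : ℂ).re := by
  rw [apply_norm_sq_eq_inner_adjoint_left (star A), ← star_eq_adjoint (star A), star_star,
    ← mul_def, ← inner_self_eq_norm_sq (𝕜 := ℂ) x, sub_apply, one_apply_eq_self, inner_sub_left,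
    Complex.sub_re, RCLike.re_eq_complex_re, sub_sub_cancel]

/-- For a contraction, `1 - A† A` is small where `A` is almost isometric. -/
theorem norm_sq_one_sub_star_mul_le (hA : ‖A‖ ≤ 1) (y : H) :
    ‖(1 - star A * A) y‖ ^ 2 ≤ ‖y‖ ^ 2 - ‖A y‖ ^ 2 := by
  have h1 := norm_apply_le_of_norm_le_one (A := star A) (by rwa [norm_star]) (A y)
  have h2 : (inner ℂ y (star A (A y)) : ℂ).re = ‖A y‖ ^ 2 := by
    rw [apply_norm_sq_eq_inner_adjoint_right, ← star_eq_adjoint]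
    rfl
  rw [sub_apply, one_apply_eq_self, mul_apply_eq_comp, @norm_sub_sq ℂ, RCLike.re_eq_complex_re, h2]
  have h3 : ‖star A (A y)‖ ^ 2 ≤ ‖A y‖ ^ 2 := by gcongr
  linarith

namespace IsGrading

theorem norm_apply_le (hq : IsGrading q) (n : ℕ) (x : H) : ‖q n x‖ ≤ ‖x‖ :=
  (pow_le_pow_iff_left₀ (norm_nonneg _) (norm_nonneg _) two_ne_zero).1
    (le_hasSum (hq.hasSum x) n fun _ _ => by positivity)

theorem apply_mem (hq : IsGrading q) (n : ℕ) (x : H) : q n x ∈ gradedPart q n := by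
  rw [mem_gradedPart, ← mul_apply_eq_comp, hq.mul_self]

/-- The identity of a graded part is the restriction of a compact operator. -/
theorem finiteDimensional (hq : IsGrading q) (n : ℕ) : FiniteDimensional ℂ (gradedPart q n) := by
  have hcl : IsClosed (gradedPart q n : Set H) := isClosed_eq (q n).continuous continuous_id
  have : CompleteSpace (gradedPart q n) := hcl.completeSpace_coe
  have h := IsCompactOperator.restrict' (f := (q n : H →ₗ[ℂ] H)) (V := gradedPart q n)
    (hq.compact n) fun v _ => hq.apply_mem n v
  refine FiniteDimensional.of_isCompactOperator_id (𝕜 := ℂ) ?_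
  have h' : (id : gradedPart q n → gradedPart q n) =
      (q n : H →ₗ[ℂ] H).restrict fun v _ => hq.apply_mem n v :=
    funext fun x => Subtype.ext x.2.symm
  rw [h']
  exact h

/-- Compact operators which preserve the degree are small in high degree: a finite net of the image
of the unit ball is almost annihilated by `q n`, `n` large. -/
theorem eventually_norm_le_of_isCompactOperator (hq : IsGrading q) {C : H →L[ℂ] H}
    (hC : IsCompactOperator C) (hCq : ∀ n, Commute C (q (n + 1))) {ε : ℝ} (hε : 0 < ε) :
    ∀ᶠ n in Filter.atTop, ∀ x ∈ gradedPart q (n + 1), ‖C x‖ ≤ ε * ‖x‖ := by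
  have h1 := hC.isCompact_closure_image_closedBall (𝕜₁ := ℂ) (f := (C : H →ₗ[ℂ] H)) 1
  have h2 := h1.totallyBounded.subset subset_closure
  obtain ⟨t, -, ht, hcov⟩ := Metric.finite_approx_of_totallyBounded h2 (ε / 2) (by positivity)
  have h3 : ∀ᶠ n in Filter.atTop, ∀ y ∈ t, ‖q n y‖ < ε / 2 := by
    refine (Filter.eventually_all_finite ht).2 fun y _ => ?_
    have h4 : Filter.Tendsto (fun n => ‖q n y‖ ^ 2) Filter.atTop (𝓝 0) :=
      (hq.hasSum y).summable.tendsto_atTop_zero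
    filter_upwards [h4.eventually (gt_mem_nhds (show 0 < (ε / 2) ^ 2 by positivity))] with n hn
    exact lt_of_pow_lt_pow_left₀ 2 (by positivity) hn
  filter_upwards [(Filter.tendsto_add_atTop_nat 1).eventually h3] with n hn
  have h5 : ∀ x ∈ gradedPart q (n + 1), ‖x‖ ≤ 1 → ‖C x‖ ≤ ε := by
    intro x hx hx1
    obtain ⟨y, hy, hxy⟩ := mem_iUnion₂.1 (hcov ⟨x, mem_closedBall_zero_iff.2 hx1, rfl⟩)
    have h6 : C x = q (n + 1) (C x - y) + q (n + 1) y := by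
      rw [← map_add, sub_add_cancel, ← mul_apply_eq_comp, ← (hCq n).eq, mul_apply_eq_comp,
        mem_gradedPart.1 hx]
    have h7 : ‖C x - y‖ < ε / 2 := by
      rw [← dist_eq_norm]
      exact hxy
    rw [h6]
    refine (norm_add_le _ _).trans ?_
    linarith [hq.norm_apply_le (n + 1) (C x - y), hn y hy]
  intro x hx
  rcases eq_or_ne x 0 with rfl | hx0
  · simp
  have hxn : 0 < ‖x‖ := norm_pos_iff.2 hx0
  have h6 := h5 (((‖x‖⁻¹ : ℝ) : ℂ) • x) (Submodule.smul_mem _ _ hx) (by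
    rw [norm_smul, Complex.norm_real, norm_inv, norm_norm, inv_mul_cancel₀ hxn.ne'])
  rw [map_smul, norm_smul, Complex.norm_real, norm_inv, norm_norm, inv_mul_le_iff₀ hxn] at h6
  linarith

theorem star_apply_mem (hq : IsGrading q) (hAq : ∀ n, A * q n = q (n + 1) * A) (n : ℕ) {x : H}
    (hx : x ∈ gradedPart q (n + 1)) : star A x ∈ gradedPart q n := by
  have h := congrArg star (hAq n)
  rw [star_mul, star_mul, hq.star_eq, hq.star_eq] at h
  rw [mem_gradedPart, ← mul_apply_eq_comp, h, mul_apply_eq_comp, mem_gradedPart.1 hx]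

theorem commute_one_sub_mul_star (hq : IsGrading q) (hAq : ∀ n, A * q n = q (n + 1) * A)
    (n : ℕ) : Commute (1 - A * star A) (q (n + 1)) := by
  refine (Commute.one_left _).sub_left ?_
  have h := congrArg star (hAq n)
  rw [star_mul, star_mul, hq.star_eq, hq.star_eq] at h
  rw [Commute, SemiconjBy, mul_assoc, ← h, ← mul_assoc, hAq, mul_assoc]

theorem eventually_le_norm_sq_star_apply (hq : IsGrading q) (hAq : ∀ n, A * q n = q (n + 1) * A)
    (hA : IsCompactOperator (1 - A * star A : H →L[ℂ] H)) {ε : ℝ} (hε : 0 < ε) :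
    ∀ᶠ n in Filter.atTop, ∀ x ∈ gradedPart q (n + 1), (1 - ε) * ‖x‖ ^ 2 ≤ ‖star A x‖ ^ 2 := by
  filter_upwards [hq.eventually_norm_le_of_isCompactOperator hA
    (hq.commute_one_sub_mul_star hAq) hε] with n hn x hx
  rw [norm_sq_star_apply]
  have h1 := (Complex.re_le_norm _).trans (norm_inner_le_norm ((1 - A * star A) x) x)
  have h2 := mul_le_mul_of_nonneg_right (hn x hx) (norm_nonneg x)
  linarith

/-- In high degree `A†` is injective, so that the dimensions of the graded parts decrease; hence
they are eventually constant, and `A†` is bijective between successive parts. -/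
theorem eventually_exists_star_apply_eq (hq : IsGrading q) (hAq : ∀ n, A * q n = q (n + 1) * A)
    (hA : IsCompactOperator (1 - A * star A : H →L[ℂ] H)) :
    ∀ᶠ n in Filter.atTop, ∀ x ∈ gradedPart q n, ∃ y ∈ gradedPart q (n + 1), star A y = x := by
  have := hq.finiteDimensional
  obtain ⟨n₀, hn₀⟩ := Filter.eventually_atTop.1
    (hq.eventually_le_norm_sq_star_apply hAq hA (ε := 1 / 2) (by norm_num))
  let B : ∀ n, gradedPart q (n + 1) →ₗ[ℂ] gradedPart q n := fun n =>
    ((star A : H →L[ℂ] H) : H →ₗ[ℂ] H).restrict fun x hx => hq.star_apply_mem hAq n hx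
  have hB : ∀ n ≥ n₀, Function.Injective (B n) := by
    intro n hn
    rw [← LinearMap.ker_eq_bot, LinearMap.ker_eq_bot']
    intro x hx
    have h1 := hn₀ n hn x x.2
    have h2 : star A (x : H) = 0 := congrArg Subtype.val hx
    rw [h2, norm_zero] at h1
    have h3 : ‖(x : H)‖ ^ 2 = 0 := le_antisymm (by linarith) (by positivity)
    exact Subtype.ext (norm_eq_zero.1 (pow_eq_zero_iff two_ne_zero |>.1 h3))
  have hanti : Antitone fun n => Module.finrank ℂ (gradedPart q (n₀ + n)) :=
    antitone_nat_of_succ_le fun n =>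
      LinearMap.finrank_le_finrank_of_injective (hB (n₀ + n) (Nat.le_add_right _ _))
  obtain ⟨n₁, hn₁⟩ := wellFoundedGT_iff_monotone_chain_condition (α := ℕᵒᵈ).1 inferInstance
    ⟨fun n => OrderDual.toDual (Module.finrank ℂ (gradedPart q (n₀ + n))), hanti⟩
  have hconst : ∀ n ≥ n₁, Module.finrank ℂ (gradedPart q (n₀ + n₁)) =
      Module.finrank ℂ (gradedPart q (n₀ + n)) := fun n hn => hn₁ n hn
  filter_upwards [Filter.eventually_ge_atTop (n₀ + n₁)] with n hn x hx
  obtain ⟨k, rfl⟩ := Nat.exists_eq_add_of_le hn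
  have h1 := hconst (n₁ + k) (Nat.le_add_right _ _)
  rw [hconst (n₁ + k + 1) (by omega), ← add_assoc n₀, ← add_assoc n₀] at h1
  obtain ⟨y, hy⟩ := (LinearMap.injective_iff_surjective_of_finrank_eq_finrank h1).1
    (hB (n₀ + n₁ + k) (by omega)) ⟨x, hx⟩
  exact ⟨y, y.2, congrArg Subtype.val hy⟩

theorem eventually_le_norm_sq_apply (hq : IsGrading q) (hAq : ∀ n, A * q n = q (n + 1) * A)
    (hA : IsCompactOperator (1 - A * star A : H →L[ℂ] H)) {ε : ℝ} (hε : 0 < ε) :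
    ∀ᶠ n in Filter.atTop, ∀ x ∈ gradedPart q n, (1 - ε) * ‖x‖ ^ 2 ≤ ‖A x‖ ^ 2 := by
  filter_upwards [hq.eventually_le_norm_sq_star_apply hAq hA hε,
    hq.eventually_exists_star_apply_eq hAq hA] with n h1 h2 x hx
  obtain ⟨y, hy, rfl⟩ := h2 x hx
  set x := star A y with hxy
  rcases eq_or_ne x 0 with h0 | h0
  · simp [h0]
  have h3 := h1 y hy
  have h4 : ‖x‖ ^ 2 ≤ ‖A x‖ * ‖y‖ := by
    rw [hxy, apply_norm_sq_eq_inner_adjoint_left (star A), ← star_eq_adjoint (star A), star_star]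
    exact (Complex.re_le_norm _).trans (norm_inner_le_norm _ _)
  have h5 : 0 < ‖x‖ ^ 2 := by positivity
  rcases le_total 1 ε with h6 | h6
  · nlinarith [sq_nonneg ‖A x‖]
  have h7 : (‖x‖ ^ 2) ^ 2 ≤ (‖A x‖ * ‖y‖) ^ 2 := by gcongr
  have h8 : (1 - ε) * (‖x‖ ^ 2) ^ 2 ≤ ‖A x‖ ^ 2 * ‖x‖ ^ 2 := by
    calc (1 - ε) * (‖x‖ ^ 2) ^ 2 ≤ (1 - ε) * (‖A x‖ * ‖y‖) ^ 2 :=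
          mul_le_mul_of_nonneg_left h7 (by linarith)
      _ = ‖A x‖ ^ 2 * ((1 - ε) * ‖y‖ ^ 2) := by ring
      _ ≤ _ := by gcongr
  refine le_of_mul_le_mul_right ?_ h5
  linarith

/-- A contraction of degree one which is essentially coisometric is essentially unitary. -/
theorem isCompactOperator_one_sub_star_mul (hq : IsGrading q) (hAn : ‖A‖ ≤ 1)
    (hAq : ∀ n, A * q n = q (n + 1) * A) (hA : IsCompactOperator (1 - A * star A : H →L[ℂ] H)) :
    IsCompactOperator (1 - star A * A : H →L[ℂ] H) := by
  refine isCompactOperator_of_approx fun ε hε => ?_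
  obtain ⟨k, hk⟩ := Filter.eventually_atTop.1
    (hq.eventually_le_norm_sq_apply hAq hA (ε := ε ^ 2) (by positivity))
  set R := ∑ n ∈ Finset.range k, q n with hR
  have hRc : IsCompactOperator R := by
    rw [← calkin_eq_zero_iff, hR, map_sum]
    exact Finset.sum_eq_zero fun n _ => calkin_eq_zero_iff.2 (hq.compact n)
  have hqR : ∀ n, q n * R = if n < k then q n else 0 := by
    intro n
    rw [hR, Finset.mul_sum]
    split_ifs with hn
    · rw [Finset.sum_eq_single_of_mem n (Finset.mem_range.2 hn) fun m _ hm =>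
        hq.mul_of_ne n m hm.symm, hq.mul_self]
    · exact Finset.sum_eq_zero fun m hm => hq.mul_of_ne n m (by
        rintro rfl
        exact hn (Finset.mem_range.1 hm))
  refine ⟨(1 - star A * A) * R, hRc.clm_comp (1 - star A * A : H →L[ℂ] H), ?_⟩
  refine opNorm_le_bound _ hε.le fun x => ?_
  set y := x - R x with hy
  have hqy : ∀ n, q n y = if n < k then 0 else q n x := by
    intro n
    have h := congrArg (fun T : H →L[ℂ] H => T x) (hqR n)
    simp only [mul_apply_eq_comp] at h
    rw [hy, map_sub, h]
    split_ifs <;> simp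
  have h1 : ‖y‖ ^ 2 ≤ ‖x‖ ^ 2 := by
    refine hasSum_le (fun n => ?_) (hq.hasSum y) (hq.hasSum x)
    rw [hqy]
    split_ifs
    · rw [norm_zero, zero_pow two_ne_zero]
      positivity
    · exact le_rfl
  have h2 : (1 - ε ^ 2) * ‖y‖ ^ 2 ≤ ‖A y‖ ^ 2 := by
    -- The degree of `A y` is at least one, so its components are the vectors `A (q n y)`.
    have h3 : ∑' n, ‖q (n + 1) (A y)‖ ^ 2 ≤ ‖A y‖ ^ 2 := by
      rw [← (hq.hasSum (A y)).tsum_eq]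
      exact tsum_comp_le_tsum_of_inj (hq.hasSum (A y)).summable (fun _ => by positivity)
        (add_left_injective 1)
    have h4 : Summable fun n => ‖q (n + 1) (A y)‖ ^ 2 :=
      (hq.hasSum (A y)).summable.comp_injective (add_left_injective 1)
    refine le_trans ?_ h3
    refine hasSum_le (fun n => ?_) ((hq.hasSum y).mul_left (1 - ε ^ 2)) h4.hasSum
    rw [← mul_apply_eq_comp, ← hAq, mul_apply_eq_comp]
    by_cases hn : n < k
    · rw [hqy, if_pos hn, map_zero, norm_zero, zero_pow two_ne_zero, mul_zero]
    · exact hk n (not_lt.1 hn) _ (hq.apply_mem n y)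
  have h3 : ((1 - star A * A) - (1 - star A * A) * R : H →L[ℂ] H) x =
      (1 - star A * A : H →L[ℂ] H) y := by
    rw [sub_apply, mul_apply_eq_comp, hy, map_sub]
  rw [h3]
  refine (pow_le_pow_iff_left₀ (norm_nonneg _) (by positivity) two_ne_zero).1 ?_
  refine (norm_sq_one_sub_star_mul_le hAn y).trans ?_
  rw [mul_pow]
  nlinarith [sq_nonneg ε]

end IsGrading

end Grading

/-! ### Compressions to quotient modules -/

section QuotientModule

open ContinuousLinearMap MvPolynomial

variable {d : ℕ} {I : Ideal (MvPolynomial (Fin d) ℂ)}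

theorem ofPoly_mem_closedSubmodule {p : MvPolynomial (Fin d) ℂ} (hp : p ∈ I) :
    ofPoly d p ∈ closedSubmodule I :=
  Submodule.le_topologicalClosure _ ⟨p, hp, rfl⟩

theorem mapsTo_closedSubmodule {T : HardySpace d →L[ℂ] HardySpace d}
    (hT : ∀ p ∈ I, T (ofPoly d p) ∈ closedSubmodule I) {f : HardySpace d}
    (hf : f ∈ closedSubmodule I) : T f ∈ closedSubmodule I := by
  have h : closedSubmodule I ≤ (closedSubmodule I).comap (T : HardySpace d →ₗ[ℂ] HardySpace d) := by
    refine Submodule.topologicalClosure_minimal _ ?_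
      ((Submodule.isClosed_topologicalClosure _).preimage T.continuous)
    rintro _ ⟨p, hp, rfl⟩
    exact hT p hp
  exact h hf

theorem star_apply_mem_quotientModule {T : HardySpace d →L[ℂ] HardySpace d}
    (hT : ∀ p ∈ I, T (ofPoly d p) ∈ closedSubmodule I) {f : HardySpace d}
    (hf : f ∈ quotientModule I) : star T f ∈ quotientModule I := by
  rw [Submodule.mem_orthogonal]
  intro g hg
  rw [star_eq_adjoint, adjoint_inner_right]
  exact Submodule.inner_right_of_mem_orthogonal (mapsTo_closedSubmodule hT hg) hf

theorem star_mulPoly_apply_mem (q : MvPolynomial (Fin d) ℂ) {f : HardySpace d}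
    (hf : f ∈ quotientModule I) : star (mulPoly q) f ∈ quotientModule I :=
  star_apply_mem_quotientModule (fun p hp => by
    rw [mulPoly_ofPoly]
    exact ofPoly_mem_closedSubmodule (I.mul_mem_left q hp)) hf

theorem star_mulPoly_apply_eq_zero {q : MvPolynomial (Fin d) ℂ} (hq : q ∈ I) {f : HardySpace d}
    (hf : f ∈ quotientModule I) : star (mulPoly q) f = 0 := by
  refine ext_inner_monomialBasis fun α => ?_
  rw [star_eq_adjoint, adjoint_inner_right, inner_zero_right, monomialBasis_eq_ofPoly,
    mulPoly_ofPoly]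
  exact Submodule.inner_right_of_mem_orthogonal
    (ofPoly_mem_closedSubmodule (I.mul_mem_right _ hq)) hf

/-- The quotient module is invariant under the adjoint of multiplication, so that no projection is
needed in the adjoint of the compression. -/
theorem coe_star_compression (q : MvPolynomial (Fin d) ℂ) (f : quotientModule I) :
    (star (compression (quotientModule I) q) f : HardySpace d) = star (mulPoly q) f := by
  have h : star (compression (quotientModule I) q) f =
      ⟨star (mulPoly q) f, star_mulPoly_apply_mem q f.2⟩ := by
    refine ext_inner_left ℂ fun y => ?_
    rw [star_eq_adjoint, adjoint_inner_right, compression, comp_apply, comp_apply,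
      Submodule.subtypeL_apply, Submodule.inner_orthogonalProjectionOnto_eq_of_mem_right,
      Submodule.coe_inner]
    exact (adjoint_inner_right (mulPoly q) (y : HardySpace d) f).symm
  rw [h]

theorem compression_mul (p q : MvPolynomial (Fin d) ℂ) :
    compression (quotientModule I) (p * q) =
      compression (quotientModule I) p * compression (quotientModule I) q := by
  apply star_injective
  ext f
  rw [star_mul, mul_apply_eq_comp, coe_star_compression, coe_star_compression,
    coe_star_compression, mulPoly_mul, star_mul, mul_apply_eq_comp]

theorem compression_one : compression (quotientModule I) 1 = 1 := by
  apply star_injective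
  ext f
  rw [coe_star_compression, ← mulPolyHom_apply, map_one, star_one, star_one, one_apply_eq_self,
    one_apply_eq_self]

theorem compression_eq_zero {q : MvPolynomial (Fin d) ℂ} (hq : q ∈ I) :
    compression (quotientModule I) q = 0 := by
  refine star_eq_zero.1 (ContinuousLinearMap.ext fun f => Subtype.ext ?_)
  rw [coe_star_compression, star_mulPoly_apply_eq_zero hq f.2]
  rfl

variable (I) in
/-- Polynomials of the compressed coordinate shifts. -/
noncomputable def compressionHom :
    MvPolynomial (Fin d) ℂ →ₐ[ℂ] (quotientModule I →L[ℂ] quotientModule I) :=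
  AlgHom.ofLinearMap
    { toFun := compression (quotientModule I)
      map_add' := fun p q => by
        simp only [compression, ← mulPolyHom_apply, map_add, add_comp, comp_add]
      map_smul' := fun c q => by
        simp only [compression, ← mulPolyHom_apply, map_smul, smul_comp, comp_smul,
          RingHom.id_apply] }
    compression_one compression_mul

theorem compressionHom_apply (q : MvPolynomial (Fin d) ℂ) :
    compressionHom I q = compression (quotientModule I) q := rfl

theorem norm_compression_X_le (j : Fin d) : ‖compression (quotientModule I) (X j)‖ ≤ 1 := by
  rw [← norm_star]
  refine opNorm_le_bound _ zero_le_one fun f => ?_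
  rw [one_mul]
  change ‖(star (compression (quotientModule I) (X j)) f : HardySpace d)‖ ≤ ‖(f : HardySpace d)‖
  rw [coe_star_compression]
  refine norm_apply_le_of_norm_le_one (A := star (shift j)) ?_ _
  rw [norm_star]
  exact norm_le_one_of_star_mul_self (star_shift_mul_shift j)

theorem one_sub_compression_mul_star (j : Fin d) :
    1 - compression (quotientModule I) (X j) * star (compression (quotientModule I) (X j)) =
      (quotientModule I).orthogonalProjectionOnto ∘L
        ((1 - shift j * star (shift j)) ∘L (quotientModule I).subtypeL) := by
  ext f
  rw [sub_apply, one_apply_eq_self, mul_apply_eq_comp]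
  conv_lhs => rw [compression, comp_apply, comp_apply, Submodule.subtypeL_apply]
  rw [← compression, coe_star_compression, comp_apply, comp_apply, Submodule.subtypeL_apply,
    sub_apply, one_apply_eq_self, mul_apply_eq_comp, map_sub]
  simp

theorem isCompactOperator_one_sub_compression_mul_star {j : Fin d}
    (hI : ∀ l ≠ j, ∃ c : ℂ, ‖c‖ ≤ 1 ∧ ∃ m : ℕ, (X l - C c * X j) ^ m ∈ I) :
    IsCompactOperator (1 - compression (quotientModule I) (X j) *
      star (compression (quotientModule I) (X j)) : quotientModule I →L[ℂ] quotientModule I) := by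
  rw [one_sub_compression_mul_star]
  refine (isCompactOperator_one_sub_shift_mul_star (N := quotientModule I) fun l hl => ?_).clm_comp
    (quotientModule I).orthogonalProjectionOnto
  obtain ⟨c, hc, m, hm⟩ := hI l hl
  refine ⟨conj c, by rwa [RCLike.norm_conj], m, fun f hf => ?_⟩
  have h : (star (shift l) - conj c • star (shift j)) ^ m =
      star (mulPoly ((X l - C c * X j) ^ m)) := by
    rw [← mulPolyHom_apply, map_pow, star_pow, map_sub, ← smul_eq_C_mul, map_smul, star_sub,
      star_smul]
    rfl
  rw [h, star_mulPoly_apply_eq_zero hm hf]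

/-! ### The grading of the quotient module of a homogeneous ideal -/

/-- The orthogonal projection of the Hardy space onto the homogeneous polynomials of degree `n`. -/
noncomputable def homogeneousProj (d n : ℕ) : HardySpace d →L[ℂ] HardySpace d :=
  truncation (Finset.piAntidiag Finset.univ n)

theorem inner_homogeneousProj (n : ℕ) (α : Fin d → ℕ) (f : HardySpace d) :
    inner ℂ (monomialBasis d α) (homogeneousProj d n f) =
      if ∑ i, α i = n then inner ℂ (monomialBasis d α) f else (0 : ℂ) := by
  classical
  rw [homogeneousProj, inner_truncation]
  congr 1
  simp [Finset.mem_piAntidiag]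

theorem star_homogeneousProj (n : ℕ) : star (homogeneousProj d n) = homogeneousProj d n := by
  have h : ∀ α : Fin d → ℕ, homogeneousProj d n (monomialBasis d α) =
      if ∑ i, α i = n then monomialBasis d α else 0 := by
    intro α
    refine ext_inner_monomialBasis fun β => ?_
    rw [inner_homogeneousProj]
    by_cases hαβ : β = α
    · subst hαβ
      split_ifs <;> simp
    · split_ifs <;> simp [inner_monomialBasis, hαβ]
  refine clm_ext_monomialBasis fun α => ext_inner_monomialBasis fun β => ?_
  rw [star_eq_adjoint, adjoint_inner_right, h β, inner_homogeneousProj]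
  split_ifs <;> simp

theorem homogeneousProj_ofPoly (n : ℕ) (p : MvPolynomial (Fin d) ℂ) :
    homogeneousProj d n (ofPoly d p) = ofPoly d (homogeneousComponent n p) := by
  have h : (homogeneousProj d n : HardySpace d →ₗ[ℂ] HardySpace d) ∘ₗ ofPoly d =
      ofPoly d ∘ₗ homogeneousComponent n := by
    refine MvPolynomial.linearMap_ext fun α => LinearMap.ext_ring ?_
    simp only [LinearMap.comp_apply, coe_coe]
    rw [homogeneousComponent_of_mem (n := α.degree) (isHomogeneous_monomial _ rfl),
      ← monomialBasis_apply]
    refine ext_inner_monomialBasis fun β => ?_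
    rw [inner_homogeneousProj, inner_monomialBasis]
    have hdeg : α.degree = ∑ i, α i := Finsupp.degree_eq_sum α
    rw [hdeg]
    by_cases hβ : β = α
    · subst hβ
      by_cases hn : ∑ i, α i = n
      · rw [if_pos hn, if_pos hn.symm, ← monomialBasis_apply, inner_monomialBasis]
      · rw [if_neg hn, if_neg (Ne.symm hn), map_zero, inner_zero_right]
    · split_ifs <;> simp [← monomialBasis_apply, inner_monomialBasis, hβ]
  exact congrArg (fun L : MvPolynomial (Fin d) ℂ →ₗ[ℂ] HardySpace d => L p) h

theorem homogeneousProj_apply_mem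
    (hI : ∀ p ∈ I, ∀ n, homogeneousComponent n p ∈ I) (n : ℕ) {f : HardySpace d}
    (hf : f ∈ quotientModule I) : homogeneousProj d n f ∈ quotientModule I := by
  rw [← star_homogeneousProj]
  refine star_apply_mem_quotientModule (fun p hp => ?_) hf
  rw [homogeneousProj_ofPoly]
  exact ofPoly_mem_closedSubmodule (hI p hp n)

/-- The projections of the quotient module of a homogeneous ideal onto its homogeneous parts. -/
noncomputable def quotientProj (hI : ∀ p ∈ I, ∀ n, homogeneousComponent n p ∈ I) (n : ℕ) :
    quotientModule I →L[ℂ] quotientModule I :=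
  (homogeneousProj d n ∘L (quotientModule I).subtypeL).codRestrict (quotientModule I)
    fun f => homogeneousProj_apply_mem hI n f.2

theorem coe_quotientProj (hI : ∀ p ∈ I, ∀ n, homogeneousComponent n p ∈ I) (n : ℕ)
    (f : quotientModule I) : (quotientProj hI n f : HardySpace d) = homogeneousProj d n f := rfl

theorem hasSum_norm_sq_homogeneousProj (f : HardySpace d) :
    HasSum (fun n => ‖homogeneousProj d n f‖ ^ 2) (‖f‖ ^ 2) := by
  have h1 := ((Equiv.sigmaFiberEquiv fun α : Fin d → ℕ => ∑ i, α i).hasSum_iff).2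
    (hasSum_inner_monomialBasis f)
  refine h1.sigma fun n => ?_
  have h2 := hasSum_inner_monomialBasis (homogeneousProj d n f)
  change HasSum ((fun α : Fin d → ℕ => ‖(inner ℂ (monomialBasis d α) f : ℂ)‖ ^ 2) ∘
    ((↑) : {α : Fin d → ℕ | ∑ i, α i = n} → Fin d → ℕ)) _
  rw [hasSum_subtype_iff_indicator]
  refine h2.congr_fun fun α => ?_
  rw [inner_homogeneousProj]
  by_cases hα : ∑ i, α i = n
  · rw [if_pos hα, indicator_of_mem (by exact hα)]
  · rw [if_neg hα, indicator_of_notMem (by exact hα), norm_zero, zero_pow two_ne_zero]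

theorem isGrading_quotientProj (hI : ∀ p ∈ I, ∀ n, homogeneousComponent n p ∈ I) :
    IsGrading (quotientProj hI) where
  star_eq n := by
    ext1 f
    refine ext_inner_left ℂ fun g => ?_
    rw [star_eq_adjoint, adjoint_inner_right, Submodule.coe_inner, Submodule.coe_inner,
      coe_quotientProj, coe_quotientProj, ← adjoint_inner_right, ← star_eq_adjoint,
      star_homogeneousProj]
  mul_self n := by
    ext f
    refine ext_inner_monomialBasis fun α => ?_
    rw [mul_apply_eq_comp, coe_quotientProj, inner_homogeneousProj, coe_quotientProj,
      inner_homogeneousProj]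
    split_ifs <;> rfl
  mul_of_ne m n hmn := by
    ext f
    refine ext_inner_monomialBasis fun α => ?_
    rw [mul_apply_eq_comp, coe_quotientProj, inner_homogeneousProj, coe_quotientProj,
      inner_homogeneousProj, zero_apply, Submodule.coe_zero, inner_zero_right]
    split_ifs with h1 h2
    · exact absurd (h1.symm.trans h2) hmn
    · rfl
    · rfl
  compact n := ((isCompactOperator_truncation _).comp_clm (quotientModule I).subtypeL).codRestrict
    (fun f => homogeneousProj_apply_mem hI n f.2) (Submodule.isClosed_orthogonal _)
  hasSum f := hasSum_norm_sq_homogeneousProj (f : HardySpace d)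

theorem compression_X_mul_quotientProj (hI : ∀ p ∈ I, ∀ n, homogeneousComponent n p ∈ I)
    (j : Fin d) (n : ℕ) :
    compression (quotientModule I) (X j) * quotientProj hI n =
      quotientProj hI (n + 1) * compression (quotientModule I) (X j) := by
  apply star_injective
  rw [star_mul, star_mul, (isGrading_quotientProj hI).star_eq, (isGrading_quotientProj hI).star_eq]
  ext f
  refine ext_inner_monomialBasis fun α => ?_
  rw [mul_apply_eq_comp, mul_apply_eq_comp, coe_quotientProj, inner_homogeneousProj,
    coe_star_compression, coe_star_compression, inner_monomialBasis_star_shift,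
    inner_monomialBasis_star_shift, coe_quotientProj, inner_homogeneousProj]
  congr 1
  simp [Finset.sum_add_distrib]

/-- If `X l - c X j` is nilpotent modulo the homogeneous ideal `I` for each `l`, with `|c| ≤ 1`,
then the compression of `z j` is essentially unitary. -/
theorem isEssentiallyUnitary_compression_X (hI : ∀ p ∈ I, ∀ n, homogeneousComponent n p ∈ I)
    {j : Fin d} (hj : ∀ l ≠ j, ∃ c : ℂ, ‖c‖ ≤ 1 ∧ ∃ m : ℕ, (X l - C c * X j) ^ m ∈ I) :
    IsEssentiallyUnitary (compression (quotientModule I) (X j)) :=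
  ⟨isCompactOperator_one_sub_compression_mul_star hj,
    (isGrading_quotientProj hI).isCompactOperator_one_sub_star_mul (norm_compression_X_le j)
      (compression_X_mul_quotientProj hI j) (isCompactOperator_one_sub_compression_mul_star hj)⟩

end QuotientModule

/-! ### The algebra of essentially quasi-prime ideals -/

section QuasiPrime

open MvPolynomial

variable {d : ℕ} {u : Fin d → ℂ} {I : Ideal (MvPolynomial (Fin d) ℂ)}

theorem norm_eq_one_of_mem_frontier (hu : u ∈ frontier (polydisc d)) : ‖u‖ = 1 := by
  rw [polydisc_eq_ball, frontier_ball _ one_ne_zero] at hu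
  exact mem_sphere_zero_iff_norm.1 hu

theorem exists_norm_eq_one_of_mem_frontier (hu : u ∈ frontier (polydisc d)) :
    ∃ j, ‖u j‖ = 1 := by
  have h1 := norm_eq_one_of_mem_frontier hu
  by_contra! h
  have h2 : ‖u‖ < 1 := (pi_norm_lt_iff one_pos).2 fun i =>
    lt_of_le_of_ne ((norm_le_pi_norm u i).trans h1.le) (h i)
  exact h2.ne h1

/-- The linear form `z l - u l conj (u j) z j`, which vanishes on the line spanned by `u` when
`‖u j‖ = 1`. -/
noncomputable def lineForm (u : Fin d → ℂ) (j l : Fin d) : MvPolynomial (Fin d) ℂ :=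
  X l - C (u l * conj (u j)) * X j

theorem isHomogeneous_lineForm (u : Fin d → ℂ) (j l : Fin d) : (lineForm u j l).IsHomogeneous 1 :=
  (isHomogeneous_X _ _).sub (isHomogeneous_C_mul_X _ _)

theorem eval_smul_of_isHomogeneous {p : MvPolynomial (Fin d) ℂ} {n : ℕ} (hp : p.IsHomogeneous n)
    (t : ℂ) (z : Fin d → ℂ) : eval (t • z) p = t ^ n * eval z p := by
  rw [eval_eq', eval_eq', Finset.mul_sum]
  refine Finset.sum_congr rfl fun α hα => ?_
  have h : α.degree = n := by
    rw [Finsupp.degree_eq_weight_one]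
    exact hp (mem_support_iff.1 hα)
  rw [← h, Finsupp.degree_eq_sum, ← Finset.prod_pow_eq_pow_sum]
  simp only [Pi.smul_apply, smul_eq_mul, mul_pow, Finset.prod_mul_distrib]
  ring

namespace PolydiscHardy.IsEssentiallyQuasiPrime

attribute [local instance] MvPolynomial.gradedAlgebra

theorem homogeneousComponent_mem_of_isHomogeneous
    (hI : I.IsHomogeneous (homogeneousSubmodule (Fin d) ℂ))
    {p : MvPolynomial (Fin d) ℂ} (hp : p ∈ I) (n : ℕ) : homogeneousComponent n p ∈ I := by
  rw [← decomposition.decompose'_apply]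
  exact hI n hp

theorem smul_mem_zeroLocus (hI : IsEssentiallyQuasiPrime u I) {z : Fin d → ℂ}
    (hz : z ∈ zeroLocus ℂ I) (t : ℂ) : t • z ∈ zeroLocus ℂ I := by
  rw [mem_zeroLocus_iff] at hz ⊢
  intro p hp
  rw [← sum_homogeneousComponent p, map_sum]
  refine Finset.sum_eq_zero fun n _ => ?_
  have h1 := hz _ (homogeneousComponent_mem_of_isHomogeneous hI.homogeneous hp n)
  have h2 := eval_smul_of_isHomogeneous (homogeneousComponent_isHomogeneous n p) t z
  rw [aeval_eq_eval] at h1 ⊢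
  rw [h2, h1, mul_zero]

/-- The zero set of `I` is a cone, hence it is the line spanned by `u`, and the Nullstellensatz
applies. -/
theorem lineForm_mem_radical (hI : IsEssentiallyQuasiPrime u I) {j : Fin d} (hj : ‖u j‖ = 1)
    (l : Fin d) : lineForm u j l ∈ I.radical := by
  rw [← vanishingIdeal_zeroLocus_eq_radical (K := ℂ), mem_vanishingIdeal_iff]
  intro z hz
  obtain ⟨t, ht0, ht⟩ : ∃ t : ℂ, t ≠ 0 ∧ t • z ∈ polydisc d := by
    refine ⟨((‖z‖ + 1)⁻¹ : ℝ), ?_, ?_⟩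
    · have : (‖z‖ + 1)⁻¹ ≠ 0 := by positivity
      exact_mod_cast this
    · rw [polydisc_eq_ball, mem_ball_zero_iff, norm_smul, Complex.norm_real, norm_inv,
        Real.norm_of_nonneg (by positivity), inv_mul_lt_iff₀ (by positivity)]
      linarith
  obtain ⟨s, -, hs⟩ : t • z ∈ disc u := by
    rw [← hI.variety]
    exact ⟨hI.smul_mem_zeroLocus hz t, ht⟩
  have hj' : conj (u j) * u j = 1 := by
    rw [Complex.conj_mul', hj]
    norm_num
  have hzi : ∀ i, t * z i = s * u i := fun i => congrFun hs i
  have h : t * (z l - u l * conj (u j) * z j) = 0 := by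
    linear_combination hzi l - u l * conj (u j) * hzi j - s * u l * hj'
  simpa [lineForm] using (mul_eq_zero.1 h).resolve_left ht0

theorem isHomogeneous_sup_unimodularIdeal (hI : IsEssentiallyQuasiPrime u I) :
    (I ⊔ unimodularIdeal u).IsHomogeneous (homogeneousSubmodule (Fin d) ℂ) := by
  refine hI.homogeneous.sup (Ideal.homogeneous_span _ _ ?_)
  rintro _ ⟨i, j, -, -, rfl⟩
  exact ⟨1, (isHomogeneous_C_mul_X _ _).sub (isHomogeneous_C_mul_X _ _)⟩

/-- The classes of the products `z j ^ k * q`, which have different degrees, cannot be linearly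
independent in the finite-dimensional space `√I / (I + J_u)`. -/
theorem exists_X_pow_mul_mem (hI : IsEssentiallyQuasiPrime u I) (j : Fin d)
    {q : MvPolynomial (Fin d) ℂ} (hq : q ∈ I.radical) {n : ℕ} (hqn : q.IsHomogeneous n) :
    ∃ k, X j ^ k * q ∈ I ⊔ unimodularIdeal u := by
  have := hI.finite_quotient
  set J := I ⊔ unimodularIdeal u with hJ
  set W := (J.restrictScalars ℂ).submoduleOf (I.radical.restrictScalars ℂ) with hW
  let v : ℕ → I.radical.restrictScalars ℂ := fun k => ⟨X j ^ k * q, I.radical.mul_mem_left _ hq⟩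
  have hdep : ¬ LinearIndependent ℂ fun k => W.mkQ (v k) := by
    intro h
    have := h.finite_of_isNoetherian
    exact not_finite ℕ
  obtain ⟨s, g, hsum, k, hk, hgk⟩ := not_linearIndependent_iff.1 hdep
  refine ⟨k, ?_⟩
  have h1 : ∑ i ∈ s, g i • (X j ^ i * q) ∈ J := by
    simp only [← map_smul, ← map_sum] at hsum
    have h2 := (Submodule.Quotient.mk_eq_zero W).1 hsum
    have h3 : ((∑ i ∈ s, g i • v i : I.radical.restrictScalars ℂ) :
        MvPolynomial (Fin d) ℂ) ∈ J := h2
    simpa [v] using h3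
  have h2 := homogeneousComponent_mem_of_isHomogeneous hI.isHomogeneous_sup_unimodularIdeal h1
    (k + n)
  have hdeg : ∀ i, (X j ^ i * q).IsHomogeneous (i + n) := fun i => by
    simpa using ((isHomogeneous_X ℂ j).pow i).mul hqn
  rw [map_sum, Finset.sum_eq_single_of_mem k hk fun i _ hik => by
    rw [map_smul, homogeneousComponent_of_mem (hdeg i), if_neg (by omega), smul_zero],
    map_smul, homogeneousComponent_of_mem (hdeg k), if_pos rfl, smul_eq_C_mul] at h2
  have h3 := J.mul_mem_left (C (g k)⁻¹) h2
  rwa [← mul_assoc, ← C_mul, inv_mul_cancel₀ hgk, C_1, one_mul] at h3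

end PolydiscHardy.IsEssentiallyQuasiPrime

end QuasiPrime

/-! ### Essential normality -/

section EssentialNormality

open ContinuousLinearMap MvPolynomial

variable {d : ℕ} {u : Fin d → ℂ} {I : Ideal (MvPolynomial (Fin d) ℂ)}

variable (I) in
/-- The class of `S_q` in the Calkin algebra, as a ring homomorphism in `q`. -/
noncomputable def essentialCompression :
    MvPolynomial (Fin d) ℂ →+* (quotientModule I →L[ℂ] quotientModule I) ⧸
      compactIdeal (quotientModule I) :=
  calkin.comp (compressionHom I : MvPolynomial (Fin d) ℂ →+* _)

theorem essentialCompression_apply (q : MvPolynomial (Fin d) ℂ) :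
    essentialCompression I q = calkin (compression (quotientModule I) q) := rfl

theorem calkin_mul_adjoint_of_isEssentiallyUnitary {H : Type*} [NormedAddCommGroup H]
    [InnerProductSpace ℂ H] [CompleteSpace H] {A : H →L[ℂ] H} (hA : IsEssentiallyUnitary A) :
    calkin A * calkin (adjoint A) = 1 := by
  rw [← map_mul, ← map_one calkin, eq_comm, ← sub_eq_zero, ← map_sub]
  exact calkin_eq_zero_iff.2 hA.1

theorem calkin_adjoint_mul_of_isEssentiallyUnitary {H : Type*} [NormedAddCommGroup H]
    [InnerProductSpace ℂ H] [CompleteSpace H] {A : H →L[ℂ] H} (hA : IsEssentiallyUnitary A) :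
    calkin (adjoint A) * calkin A = 1 := by
  rw [← map_mul, ← map_one calkin, eq_comm, ← sub_eq_zero, ← map_sub]
  exact calkin_eq_zero_iff.2 hA.2

theorem PolydiscHardy.IsEssentiallyUnitary.smul {H : Type*} [NormedAddCommGroup H]
    [InnerProductSpace ℂ H] [CompleteSpace H] {A : H →L[ℂ] H} (hA : IsEssentiallyUnitary A)
    {c : ℂ} (hc : ‖c‖ = 1) : IsEssentiallyUnitary (c • A) := by
  have h1 : c * conj c = 1 := by
    rw [Complex.mul_conj', hc]
    norm_num
  constructor
  · rw [map_smulₛₗ, smul_comp, comp_smul, smul_smul, h1, one_smul]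
    exact hA.1
  · rw [map_smulₛₗ, smul_comp, comp_smul, smul_smul, mul_comm, h1, one_smul]
    exact hA.2

namespace PolydiscHardy.IsEssentiallyQuasiPrime

theorem isEssentiallyUnitary_compression (hI : IsEssentiallyQuasiPrime u I) (hu : ‖u‖ ≤ 1)
    {j : Fin d} (hj : ‖u j‖ = 1) : IsEssentiallyUnitary (compression (quotientModule I) (X j)) := by
  refine isEssentiallyUnitary_compression_X
    (fun p hp n => homogeneousComponent_mem_of_isHomogeneous hI.homogeneous hp n) fun l _ =>
    ⟨u l * conj (u j), ?_, hI.lineForm_mem_radical hj l⟩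
  rw [norm_mul, RCLike.norm_conj, hj, mul_one]
  exact (norm_le_pi_norm u l).trans hu

/-- For unimodular coordinates `u i` and `u j`, the classes of `S_{z_i}` and
`u i conj (u j) S_{z_j}` are commuting unitaries with a nilpotent difference. -/
theorem essentialCompression_lineForm_of_norm_eq_one (hI : IsEssentiallyQuasiPrime u I)
    (hu : ‖u‖ ≤ 1) {i j : Fin d} (hi : ‖u i‖ = 1) (hj : ‖u j‖ = 1) :
    essentialCompression I (lineForm u j i) = 0 := by
  have hc : ‖u i * conj (u j)‖ = 1 := by rw [norm_mul, RCLike.norm_conj, hi, hj, mul_one]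
  have h1 := hI.isEssentiallyUnitary_compression hu hi
  have h2 := (hI.isEssentiallyUnitary_compression hu hj).smul hc
  obtain ⟨m, hm⟩ := hI.lineForm_mem_radical hj i
  have h3 : compression (quotientModule I) (lineForm u j i) =
      compression (quotientModule I) (X i) -
        (u i * conj (u j)) • compression (quotientModule I) (X j) := by
    simp only [← compressionHom_apply, lineForm, ← smul_eq_C_mul, map_sub, map_smul]
  have hcomm : Commute (compression (quotientModule I) (X i))
      ((u i * conj (u j)) • compression (quotientModule I) (X j)) := by
    refine Commute.smul_right ?_ _
    rw [Commute, SemiconjBy, ← compression_mul, ← compression_mul, mul_comm]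
  rw [essentialCompression_apply, h3, map_sub, sub_eq_zero]
  refine calkin_eq_of_unitary_of_nilpotent (m := m) hcomm
    (calkin_adjoint_mul_of_isEssentiallyUnitary h1) (calkin_mul_adjoint_of_isEssentiallyUnitary h1)
    (calkin_adjoint_mul_of_isEssentiallyUnitary h2)
    (calkin_mul_adjoint_of_isEssentiallyUnitary h2) ?_
  rw [← map_sub, ← h3, ← essentialCompression_apply, ← map_pow, essentialCompression_apply,
    compression_eq_zero hm, map_zero]

theorem sup_unimodularIdeal_le_ker (hI : IsEssentiallyQuasiPrime u I) (hu : ‖u‖ ≤ 1) :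
    I ⊔ unimodularIdeal u ≤ RingHom.ker (essentialCompression I) := by
  refine sup_le (fun q hq => ?_) (Ideal.span_le.2 ?_)
  · rw [RingHom.mem_ker, essentialCompression_apply, compression_eq_zero hq, map_zero]
  · rintro _ ⟨i, j, hi, hj, rfl⟩
    have h1 : conj (u i) * u i = 1 := by
      rw [Complex.conj_mul', hi]
      norm_num
    have h2 : C (conj (u i)) * X i - C (conj (u j)) * X j = C (conj (u i)) * lineForm u j i := by
      rw [lineForm, mul_sub, ← mul_assoc, ← C_mul, ← mul_assoc, h1, one_mul]
    rw [SetLike.mem_coe, RingHom.mem_ker, h2, map_mul,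
      hI.essentialCompression_lineForm_of_norm_eq_one hu hi hj, mul_zero]

/-- Some product `z j ^ k * (z i - u i conj (u j) z j)` lies in `I + J_u`, whose elements have
compact compressions, and the class of `S_{z_j}` is invertible. -/
theorem essentialCompression_lineForm (hI : IsEssentiallyQuasiPrime u I) (hu : ‖u‖ ≤ 1)
    {j : Fin d} (hj : ‖u j‖ = 1) (i : Fin d) : essentialCompression I (lineForm u j i) = 0 := by
  obtain ⟨k, hk⟩ := hI.exists_X_pow_mul_mem j (hI.lineForm_mem_radical hj i)
    (isHomogeneous_lineForm u j i)
  have h1 := hI.sup_unimodularIdeal_le_ker hu hk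
  rw [RingHom.mem_ker, map_mul, map_pow] at h1
  have h2 := calkin_adjoint_mul_of_isEssentiallyUnitary (hI.isEssentiallyUnitary_compression hu hj)
  rw [← essentialCompression_apply] at h2
  have h3 : IsUnit (essentialCompression I (X j)) :=
    ⟨⟨_, _, calkin_mul_adjoint_of_isEssentiallyUnitary
      (hI.isEssentiallyUnitary_compression hu hj), h2⟩, rfl⟩
  exact (h3.pow k).mul_right_eq_zero.1 h1

end PolydiscHardy.IsEssentiallyQuasiPrime

/-- Compact perturbations of multiples of an essentially unitary operator satisfy the commutator
condition. -/
theorem isCompactOperator_commutator {H : Type*} [NormedAddCommGroup H] [InnerProductSpace ℂ H]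
    [CompleteSpace H] {S A B K L : H →L[ℂ] H} (hS : IsEssentiallyUnitary S)
    (hK : IsCompactOperator K) (hL : IsCompactOperator L) {a b : ℂ} (hA : A = a • S + K)
    (hB : B = b • S + L) : IsCompactOperator (adjoint A ∘L B - B ∘L adjoint A) := by
  have hSS : calkin (adjoint S * S) = calkin (S * adjoint S) := by
    rw [map_mul, map_mul, calkin_adjoint_mul_of_isEssentiallyUnitary hS,
      calkin_mul_adjoint_of_isEssentiallyUnitary hS]
  have hA' : calkin (adjoint A) = calkin (conj a • adjoint S) := by
    rw [hA, map_add, map_smulₛₗ, map_add, calkin_eq_zero_iff.2 hK.adjoint, add_zero]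
  have hB' : calkin B = calkin (b • S) := by
    rw [hB, map_add, calkin_eq_zero_iff.2 hL, add_zero]
  have h : IsCompactOperator (adjoint S * S - S * adjoint S : H →L[ℂ] H) := by
    rw [← calkin_eq_zero_iff, map_sub, hSS, sub_self]
  rw [← ContinuousLinearMap.mul_def, ← ContinuousLinearMap.mul_def, ← calkin_eq_zero_iff, map_sub,
    map_mul, map_mul, hA', hB', ← map_mul, ← map_mul, ← map_sub, smul_mul_smul_comm,
    smul_mul_smul_comm, mul_comm b, ← smul_sub]
  exact calkin_eq_zero_iff.2 (h.smul (conj a * b))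

end EssentialNormality

theorem mainTheorem5 (d : ℕ) (u : Fin d → ℂ) (hu : u ∈ frontier (polydisc d))
    (I : Ideal (MvPolynomial (Fin d) ℂ)) (hI : IsEssentiallyQuasiPrime u I) :
    IsEssentiallyNormal (quotientModule I) ∧
      ∃ S : quotientModule I →L[ℂ] quotientModule I,
        IsEssentiallyUnitary S ∧
          ∃ K : Fin d → (quotientModule I →L[ℂ] quotientModule I),
            (∀ i, IsCompactOperator (K i)) ∧
              ∀ i, compression (quotientModule I) (MvPolynomial.X i) = u i • S + K i := by
  have hu1 := (norm_eq_one_of_mem_frontier hu).le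
  obtain ⟨j, hj⟩ := exists_norm_eq_one_of_mem_frontier hu
  set S := conj (u j) • compression (quotientModule I) (MvPolynomial.X j) with hS
  set K := fun i => compression (quotientModule I) (lineForm u j i) with hK
  have hSu : IsEssentiallyUnitary S :=
    (hI.isEssentiallyUnitary_compression hu1 hj).smul (by rw [RCLike.norm_conj, hj])
  have hKc : ∀ i, IsCompactOperator (K i) := fun i =>
    calkin_eq_zero_iff.1 (hI.essentialCompression_lineForm hu1 hj i)
  have hSK : ∀ i, compression (quotientModule I) (MvPolynomial.X i) = u i • S + K i := fun i => by
    simp only [hS, hK, ← compressionHom_apply, lineForm, ← MvPolynomial.smul_eq_C_mul,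
      map_sub, map_smul, smul_smul, add_sub_cancel]
  exact ⟨fun i k => isCompactOperator_commutator hSu (hKc i) (hKc k) (hSK i) (hSK k),
    S, hSu, K, hKc, hSK⟩
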